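/- **Theorem.** Let $\kappa\ge 3$ and $n\ge 3$ be integers; indices $j\in\{1,\dots,\kappa\}$ are cyclic ($j-1$ means $\kappa$ if $j=1$, $j+1$ means $1$ if $j=\kappa$). Let $\mathfrak C_\kappa\subset\mathbb R^2$ be the regular $\kappa$-gon of area $1$ whose first side is the segment from $(0,0)$ to $(r_\kappa,0)$ and which lies in the upper half-plane, with sides numbered counterclockwise, side length $r_\kappa=\sqrt{4\tan(\pi/\kappa)/\kappa}$ and interior angle $\theta_\kappa=(\kappa-2)\pi/\kappa$. *Canonical order.* Let $\mathcal C_\kappa(n)$ be the set of $n$-tuples $z=(z_1,\dots,z_n)$ of points of $\mathfrak C_\kappa$ that are the $n$ distinct vertices of a convex polygon, such that $z_1$ is the lowest point (the leftmost one among the lowest) and the points are listed counterclockwise, i.e. with $z_{n+1}=z_1$ the arguments in $[0,2\pi)$ of $z_{i+1}-z_i$, $1\le i\le n$, are non-decreasing. *Distances and sizes.* For $z\in\mathcal C_\kappa(n)$ let $\ell_j(z)$ be the minimal distance of the points $z_1,\dots,z_n$ to the line supporting the $j$-th side of $\mathfrak C_\kappa$, and $\ell(z)=(\ell_1(z),\dots,\ell_\kappa(z))$.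 The $j$-th contact point $\mathsf{cp}_j$ is the lexicographically smallest among the $z_i$ that realise this minimum, and $s_j(z)\in\{0,\dots,n-1\}$ is the integer such that $\mathsf{cp}_{j+1}=z_{k+s_j(z)}$ (indices modulo $n$) if $\mathsf{cp}_j=z_k$; $s(z)=(s_1(z),\dots,s_\kappa(z))$. *The law.* Let $$\mathbb N_\kappa(n)=\Big\{s\in\mathbb N^\kappa:\ \sum_{j=1}^{\kappa}s_j=n,\ s_{j-1}+s_j\ne 0\text{ for all }j\Big\},\qquad \mathcal C_\kappa(\mathbb N_\kappa(n))=\{z\in\mathcal C_\kappa(n):\ s(z)\in\mathbb N_\kappa(n)\}.$$ Let $\mathbb U_\kappa^{(n)}$ be the law of $n$ independent uniform points of $\mathfrak C_\kappa$, let $\widetilde{\mathbb P}_\kappa(n)=n!\,\mathbb U_\kappa^{(n)}\big(\mathcal C_\kappa(\mathbb N_\kappa(n))\big)$, and, when this is positive, let $\mathbb D_\kappa^{(n)}$ be $\mathbb U_\kappa^{(n)}$ conditioned on $\mathcal C_\kappa(\mathbb N_\kappa(n))$. Finally let $$\mathfrak{cl}_j(\ell)=\frac{\ell_{j-1}+\ell_{j+1}+2\ell_j\cos\theta_\kappa}{\sin\theta_\kappa},\qquad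 \mathcal L_\kappa=\big\{\ell\in\mathbb R^\kappa:\ \ell_j\ge 0\text{ and }\mathfrak{cl}_j(\ell)\le r_\kappa\text{ for all }j\big\}.$$ *Claim.* If the random tuple $\mathbf z$ has law $\mathbb D_\kappa^{(n)}$, then $\ell(\mathbf z)$ and $s(\mathbf z)$ are random variables and, for every $s\in\mathbb N^\kappa$ and every Borel set $A\subset\mathbb R^\kappa$, $$\mathbb P\big(\ell(\mathbf z)\in A,\ s(\mathbf z)=s\big)=\int_A f_\kappa^{(n)}(\ell,s)\,\mathrm d\ell,$$ where, with $c_j=r_\kappa-\mathfrak{cl}_j(\ell)$, $$f_\kappa^{(n)}(\ell,s)=\frac{n!\,\sin(\theta_\kappa)^{\,n-\kappa}}{\widetilde{\mathbb P}_\kappa(n)}\,\mathbf 1_{s\in\mathbb N_\kappa(n)}\,\mathbf 1_{\ell\in\mathcal L_\kappa}\prod_{j=1}^{\kappa}\frac{c_j^{\,s_{j-1}+s_j-1}}{s_j!\,(s_{j-1}+s_j-1)!}.$$ -/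

import Mathlib

open MeasureTheory ProbabilityTheory
open scoped Nat

noncomputable section

/-- The interior angle `θ_κ = (κ - 2)π / κ` of a regular `κ`-gon. -/
def interiorAngle (κ : ℕ) : ℝ := (κ - 2) * Real.pi / κ

/-- The side length `r_κ = √(4 tan(π/κ) / κ)` of the regular `κ`-gon of area `1`. -/
def sideLength (κ : ℕ) : ℝ := Real.sqrt (4 * Real.tan (Real.pi / κ) / κ)

/-- The vertices of the regular `κ`-gon (the plane is identified with `ℂ`), in counterclockwise
order: vertex `0` is the origin, and the `m`-th side leaves vertex `m` with length `r_κ` and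
direction `2πm/κ`. Hence side `0` is the segment from `0` to `r_κ` on the horizontal axis. -/
def polyVertex (κ m : ℕ) : ℂ :=
  ∑ i ∈ Finset.range m,
    (sideLength κ : ℂ) * Complex.exp (((2 * Real.pi * i / κ : ℝ) : ℂ) * Complex.I)

/-- The regular `κ`-gon of area `1`, as a closed convex region of the plane. -/
def regularPolygon (κ : ℕ) : Set ℂ :=
  convexHull ℝ (Set.range fun j : Fin κ => polyVertex κ j)

/-- The straight line that supports the `j`-th side of the regular `κ`-gon. -/
def sideLine (κ : ℕ) (j : Fin κ) : AffineSubspace ℝ ℂ :=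
  affineSpan ℝ {polyVertex κ j, polyVertex κ (j + 1 : ℕ)}

/-- The law of `n` independent uniform points of the regular `κ`-gon. -/
def uniformLaw (κ n : ℕ) : Measure (Fin n → ℂ) :=
  Measure.pi fun _ => cond volume (regularPolygon κ)

/-- The argument of `w`, taken in `[0, 2π)`. -/
def planeAngle (w : ℂ) : ℝ := toIcoMod Real.two_pi_pos 0 (Complex.arg w)

/-- Convex canonical order (for `n ≥ 3`): the points are the `n` distinct vertices of a convex
polygon, the first one is the lowest (the leftmost one of the lowest), and they are listed
counterclockwise, that is, the arguments in `[0, 2π)` of the successive edges are non-decreasing,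
the closing edge from the last point to the first one being included. -/
def IsCanonical {n : ℕ} (z : Fin n → ℂ) : Prop :=
  ConvexIndependent ℝ z ∧
  (∀ i₀ i : Fin n, (i₀ : ℕ) = 0 →
    (z i₀).im < (z i).im ∨ (z i₀).im = (z i).im ∧ (z i₀).re ≤ (z i).re) ∧
  Monotone fun i : Fin n => planeAngle (z (finRotate n i) - z i)

/-- `𝒞_κ(n)`: the `n`-tuples of points of the regular `κ`-gon in convex canonical order. -/
def canonicalSet (κ n : ℕ) : Set (Fin n → ℂ) :=
  {z | IsCanonical z ∧ ∀ i, z i ∈ regularPolygon κ}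

/-- `ℓ_j(z)`: the distance from (the line supporting) the `j`-th side of the regular `κ`-gon
to the set of points `z`. -/
def sideDist (κ : ℕ) {n : ℕ} (z : Fin n → ℂ) (j : Fin κ) : ℝ :=
  ⨅ i, Metric.infDist (z i) (sideLine κ j : Set ℂ)

/-- The point `z i` lies on the `j`-th side of the circumscribed equiangular polygon, i.e. it is
one of the points of `z` nearest to the `j`-th side of the regular `κ`-gon. -/
def OnECPSide (κ : ℕ) {n : ℕ} (z : Fin n → ℂ) (j : Fin κ) (i : Fin n) : Prop :=
  Metric.infDist (z i) (sideLine κ j : Set ℂ) = sideDist κ z j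

/-- The index `k` of the `j`-th contact point `z k`: among the points on the `j`-th side of the
circumscribed equiangular polygon, the lexicographically smallest one. (It is unique when the
points are distinct; indices start from `0`.) -/
def contactIndex (κ : ℕ) {n : ℕ} (z : Fin n → ℂ) (j : Fin κ) : ℕ :=
  sInf {k | ∃ hk : k < n, OnECPSide κ z j ⟨k, hk⟩ ∧
    ∀ i, OnECPSide κ z j i →
      (z ⟨k, hk⟩).re < (z i).re ∨ (z ⟨k, hk⟩).re = (z i).re ∧ (z ⟨k, hk⟩).im ≤ (z i).im}

/-- The size-vector `s(z)`: `s_j` is the number of steps, along the cyclic list of the points `z`,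
from the `j`-th contact point to the next one (the `(j+1)`-th, cyclically in `j`). -/
def sizeVector (κ : ℕ) {n : ℕ} (z : Fin n → ℂ) (j : Fin κ) : ℕ :=
  (contactIndex κ z (finRotate κ j) + n - contactIndex κ z j) % n

/-- `ℕ_κ(n)`: the vectors `s ∈ ℕ^κ` of sum `n` with `s_{j-1} + s_j ≠ 0` for all `j`, cyclically. -/
def admissibleSizes (κ n : ℕ) : Set (Fin κ → ℕ) :=
  {s | ∑ j, s j = n ∧ ∀ j, s ((finRotate κ).symm j) + s j ≠ 0}

/-- `𝒞_κ(ℕ_κ(n))`: the canonically ordered tuples whose size-vector is in `ℕ_κ(n)`. -/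
def fullSidedSet (κ n : ℕ) : Set (Fin n → ℂ) :=
  {z | z ∈ canonicalSet κ n ∧ sizeVector κ z ∈ admissibleSizes κ n}

/-- `P̃_κ(n) = n! · 𝕌(𝒞_κ(ℕ_κ(n)))`. -/
def fullSidedProb (κ n : ℕ) : ℝ := n ! * (uniformLaw κ n).real (fullSidedSet κ n)

/-- `𝔻_κ^{(n)}`: the law of `n` independent uniform points of the regular `κ`-gon, conditioned to
be in `𝒞_κ(ℕ_κ(n))`. -/
def fullSidedLaw (κ n : ℕ) : Measure (Fin n → ℂ) :=
  cond (uniformLaw κ n) (fullSidedSet κ n)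

/-- `cl_j(ℓ) = (ℓ_{j-1} + ℓ_{j+1} + 2 ℓ_j cos θ_κ) / sin θ_κ`, with cyclic indices. -/
def sideComb (κ : ℕ) (l : Fin κ → ℝ) (j : Fin κ) : ℝ :=
  (l ((finRotate κ).symm j) + l (finRotate κ j) + 2 * l j * Real.cos (interiorAngle κ)) /
    Real.sin (interiorAngle κ)

/-- `ℒ_κ`: the vectors `ℓ` with nonnegative entries and `cl_j(ℓ) ≤ r_κ` for all `j`. -/
def distDomain (κ : ℕ) : Set (Fin κ → ℝ) :=
  {l | (∀ j, 0 ≤ l j) ∧ ∀ j, sideComb κ l j ≤ sideLength κ}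

/-- The joint density `f_κ^{(n)}(ℓ, s)`, in which `c_j = r_κ - cl_j(ℓ)`. The exponent `n - κ` is an
integer, possibly negative; the exponent `s_{j-1} + s_j - 1` is at least `0` for `s ∈ ℕ_κ(n)`. -/
def jointDensity (κ n : ℕ) (l : Fin κ → ℝ) (s : Fin κ → ℕ) : ℝ :=
  n ! * Real.sin (interiorAngle κ) ^ ((n : ℤ) - (κ : ℤ)) / fullSidedProb κ n *
    (admissibleSizes κ n).indicator (fun _ => (1 : ℝ)) s *
    (distDomain κ).indicator (fun _ => (1 : ℝ)) l *
    ∏ j, (sideLength κ - sideComb κ l j) ^ (s ((finRotate κ).symm j) + s j - 1) /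
      ((s j)! * (s ((finRotate κ).symm j) + s j - 1)! : ℝ)

end

/-!
Conditioning on `𝒞_κ(ℕ_κ(n))` only divides by the probability of this event, and the regular polygon
has area `1` (`volume_regularPolygon`), so that the uniform law of `n` points is Lebesgue measure
restricted to a product (`uniformLaw_eq`). The claim is therefore a formula for the Lebesgue measure
of the set of canonically ordered tuples `z` with `s(z) = s` and `ℓ(z) ∈ A`
(`volume_fullSided_event`). Null sets may be neglected: two points are almost never at the same
distance of a side, and two edges almost never have the same direction (`ae_generic`,
`ae_planeAngle_edge_injective`).

The `j`-th contact point is where the angles of the edges pass the direction of the `j`-th side. Cut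
the indices `1, …, n` into consecutive blocks of sizes `s_1, …, s_κ`. For an admissible `s`, the tuple
`z` is canonically ordered with `s(z) = s` if and only if its edges are sorted by angle, each edge of
the `j`-th block lies in the cone `InCones` between the directions of the sides `j` and `j + 1`, and
the contact points, now at known indices, lie in the half-planes of their sides; then `ℓ(z)` is the
vector of the distances `contactHeights` (`mem_fullSidedSet_of_inCones`, `inCones_of_mem_fullSidedSet`,
`sideDist_eq_contactHeights`).

The condition that the edges are sorted is traded for a factor: rearranging the edges inside the
blocks preserves the volume, the cones and the contact points, and exactly one of the `∏ s_j!`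
rearrangements is sorted (`volume_inCones_eq_mul`).

It remains to compute the volume of the tuples with edges in their cones (`volume_inCones`). Such an
edge is a sum of two vectors with the directions of the sides that bound its cone; `edgeComp` are the
lengths of these, multiplied by `sin θ_κ`, and the edge is in the cone if and only if both are
nonnegative. There are `s_{j-1} + s_j` components along the `j`-th side, and their lengths add up to
the length `c_j = r_κ - cl_j(ℓ)` of the `j`-th side of the circumscribed equiangular polygon
(`sum_edgeComp`). Omit one component on each side: given `ℓ`, the remaining `2n - κ` ones describe a
product of simplices of dimensions `s_{j-1} + s_j - 1` and sizes `sin(θ_κ) c_j`, which has volume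
`∏ (sin(θ_κ) c_j)^(s_{j-1}+s_j-1) / (s_{j-1}+s_j-1)!` (`volume_simplexProd`). Finally `ℓ` and these
components are linear coordinates on the space of `n` points, with Jacobian `sin(θ_κ)^n`
(`exists_coordinates`): each point contributes `sin θ_κ` when it is described by its distances to two
neighbouring sides, and passing from the distances to their increments along the polygon is a
unipotent map. The powers of the sine combine to `sin(θ_κ)^(n-κ)` (`prod_simplexVol_eq`).
-/

/-! ### Heights over the sides of the regular polygon -/

/-- The unit vector of angle `α`. -/
noncomputable def unitDir (α : ℝ) : ℂ := ⟨Real.cos α, Real.sin α⟩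

/-- The signed height of a vector over the oriented line through `0` of direction `α`, positive
to the left of the line. -/
noncomputable def height (α : ℝ) : ℂ →ₗ[ℝ] ℝ := Real.cos α • Complex.imLm - Real.sin α • Complex.reLm

lemma height_apply (α : ℝ) (z : ℂ) : height α z = Real.cos α * z.im - Real.sin α * z.re := by
  simp [height]

lemma unitDir_eq_exp (α : ℝ) : unitDir α = Complex.exp (α * Complex.I) := by
  rw [Complex.exp_mul_I]
  apply Complex.ext <;> simp [unitDir, Complex.cos_ofReal_re, Complex.sin_ofReal_re]

lemma unitDir_add (α β : ℝ) : unitDir (α + β) = unitDir α * unitDir β := by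
  apply Complex.ext <;> simp [unitDir, Real.cos_add, Real.sin_add]; ring

lemma norm_unitDir (α : ℝ) : ‖unitDir α‖ = 1 := by
  rw [unitDir_eq_exp, Complex.norm_exp_ofReal_mul_I]

lemma height_mul_unitDir (α β : ℝ) (w : ℂ) : height α (w * unitDir β) = height (α - β) w := by
  simp only [height_apply, unitDir, Complex.mul_re, Complex.mul_im, Real.cos_sub, Real.sin_sub]
  ring

lemma height_zero_apply (w : ℂ) : height 0 w = w.im := by simp [height_apply]

lemma height_add_add_height_sub (α δ : ℝ) (z : ℂ) :
    height (α + δ) z + height (α - δ) z = 2 * Real.cos δ * height α z := by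
  simp only [height_apply, Real.cos_add, Real.sin_add, Real.cos_sub, Real.sin_sub]; ring

lemma height_add_two_pi (α : ℝ) : height (α + 2 * Real.pi) = height α := by
  ext; simp [height_apply]

lemma abs_height_le_norm (α : ℝ) (z : ℂ) : |height α z| ≤ ‖z‖ := by
  have h : height α z = (z * unitDir (-α)).im := by
    simp [height_apply, unitDir]; ring
  rw [h]
  refine (Complex.abs_im_le_norm _).trans ?_
  rw [norm_mul, norm_unitDir, mul_one]

@[fun_prop]
lemma continuous_height (α : ℝ) : Continuous (height α) := (height α).continuous_of_finiteDimensional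

/-- A vector whose height over the direction `α` vanishes is parallel to this direction. -/
lemma eq_smul_unitDir_of_height_eq_zero {α : ℝ} {z : ℂ} (h : height α z = 0) :
    z = (Real.cos α * z.re + Real.sin α * z.im : ℝ) • unitDir α := by
  rw [height_apply] at h
  have hs := Real.sin_sq_add_cos_sq α
  apply Complex.ext
  · simp only [unitDir, Complex.smul_re, smul_eq_mul]
    linear_combination (Real.sin α) * h * (-1) - z.re * hs
  · simp only [unitDir, Complex.smul_im, smul_eq_mul]
    linear_combination (Real.cos α) * h - z.im * hs

lemma planeAngle_mem (w : ℂ) : 0 ≤ planeAngle w ∧ planeAngle w < 2 * Real.pi := by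
  have := toIcoMod_mem_Ico Real.two_pi_pos 0 (Complex.arg w)
  simpa [planeAngle] using this

lemma unitDir_planeAngle (w : ℂ) : (‖w‖ : ℂ) * unitDir (planeAngle w) = w := by
  have h : unitDir (planeAngle w) = unitDir (Complex.arg w) := by
    have h1 : planeAngle w = Complex.arg w - toIcoDiv Real.two_pi_pos 0 (Complex.arg w) * (2 * Real.pi) := by
      rw [planeAngle, toIcoMod]; simp
    rw [h1]
    apply Complex.ext
    · exact Real.cos_sub_int_mul_two_pi _ _
    · exact Real.sin_sub_int_mul_two_pi _ _
  rw [h, unitDir_eq_exp, Complex.norm_mul_exp_arg_mul_I]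

lemma height_eq_norm_mul_sin (α : ℝ) (w : ℂ) :
    height α w = ‖w‖ * Real.sin (planeAngle w - α) := by
  conv_lhs => rw [← unitDir_planeAngle w]
  rw [height_mul_unitDir, height_apply, Complex.ofReal_im, Complex.ofReal_re,
    ← neg_sub (α) (planeAngle w), Real.sin_neg]
  ring

/-- The direction `2πj/κ` of the `j`-th side. -/
noncomputable def sideAngle (κ j : ℕ) : ℝ := 2 * Real.pi * j / κ

/-- The distance from the centre of the regular polygon to its sides. -/
noncomputable def apothem (κ : ℕ) : ℝ := sideLength κ / (2 * Real.tan (Real.pi / κ))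

/-- The centre of the regular polygon. -/
noncomputable def polyCenter (κ : ℕ) : ℂ := ⟨sideLength κ / 2, apothem κ⟩

/-- The signed distance to the line that supports the `j`-th side of the regular polygon,
nonnegative on the side of the polygon. -/
noncomputable def sideHeight (κ j : ℕ) (z : ℂ) : ℝ := apothem κ + height (sideAngle κ j) (z - polyCenter κ)

@[fun_prop]
lemma continuous_sideHeight (κ j : ℕ) : Continuous (sideHeight κ j) := by
  unfold sideHeight; fun_prop

lemma sideHeight_sub (κ j : ℕ) (z w : ℂ) :
    sideHeight κ j z - sideHeight κ j w = height (sideAngle κ j) (z - w) := by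
  have : z - w = (z - polyCenter κ) - (w - polyCenter κ) := by ring
  rw [this, map_sub, sideHeight, sideHeight]; ring

section Regular

variable {κ : ℕ}

lemma sideAngle_zero (κ : ℕ) : sideAngle κ 0 = 0 := by simp [sideAngle]

lemma sideAngle_self (hκ : 3 ≤ κ) : sideAngle κ κ = 2 * Real.pi := by
  have : (κ : ℝ) ≠ 0 := by positivity
  simp [sideAngle]; field_simp

lemma sideAngle_succ (κ j : ℕ) : sideAngle κ (j + 1) = sideAngle κ j + 2 * Real.pi / κ := by
  simp [sideAngle]; ring

lemma sideAngle_mono (κ : ℕ) : Monotone (sideAngle κ) := by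
  intro i j h
  unfold sideAngle
  have : (i : ℝ) ≤ j := by exact_mod_cast h
  have := Real.pi_pos
  gcongr

lemma sideAngle_lt_two_pi (hκ : 3 ≤ κ) {j : ℕ} (hj : j < κ) : sideAngle κ j < 2 * Real.pi := by
  have h0 : (0 : ℝ) < κ := by positivity
  have : (j : ℝ) < κ := by exact_mod_cast hj
  have := Real.pi_pos
  rw [sideAngle, div_lt_iff₀ h0]; gcongr

lemma sideAngle_nonneg (κ j : ℕ) : 0 ≤ sideAngle κ j := by
  have := Real.pi_pos
  unfold sideAngle; positivity

lemma step_pos (hκ : 3 ≤ κ) : 0 < 2 * Real.pi / κ := by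
  have := Real.pi_pos
  positivity

lemma step_lt_pi (hκ : 3 ≤ κ) : 2 * Real.pi / κ < Real.pi := by
  have h0 : (3 : ℝ) ≤ κ := by exact_mod_cast hκ
  have := Real.pi_pos
  rw [div_lt_iff₀ (by linarith)]; nlinarith

lemma sin_step_pos (hκ : 3 ≤ κ) : 0 < Real.sin (2 * Real.pi / κ) :=
  Real.sin_pos_of_pos_of_lt_pi (step_pos hκ) (step_lt_pi hκ)

lemma sin_half_step_pos (hκ : 3 ≤ κ) : 0 < Real.sin (Real.pi / κ) := by
  have := step_lt_pi hκ
  have := step_pos hκ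
  have h : Real.pi / κ = (2 * Real.pi / κ) / 2 := by ring
  exact Real.sin_pos_of_pos_of_lt_pi (by rw [h]; linarith) (by rw [h]; linarith)

lemma cos_half_step_pos (hκ : 3 ≤ κ) : 0 < Real.cos (Real.pi / κ) := by
  have := step_lt_pi hκ
  have := step_pos hκ
  have h : Real.pi / κ = (2 * Real.pi / κ) / 2 := by ring
  exact Real.cos_pos_of_mem_Ioo ⟨by rw [h]; linarith, by rw [h]; linarith⟩

lemma tan_half_step_pos (hκ : 3 ≤ κ) : 0 < Real.tan (Real.pi / κ) := by
  rw [Real.tan_eq_sin_div_cos]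
  exact div_pos (sin_half_step_pos hκ) (cos_half_step_pos hκ)

lemma sideLength_pos (hκ : 3 ≤ κ) : 0 < sideLength κ := by
  have := tan_half_step_pos hκ
  unfold sideLength; positivity

lemma apothem_pos (hκ : 3 ≤ κ) : 0 < apothem κ := by
  have := tan_half_step_pos hκ
  have := sideLength_pos hκ
  unfold apothem; positivity

lemma interiorAngle_eq (hκ : 3 ≤ κ) : interiorAngle κ = Real.pi - 2 * Real.pi / κ := by
  have : (κ : ℝ) ≠ 0 := by positivity
  unfold interiorAngle; field_simp

lemma sin_interiorAngle (hκ : 3 ≤ κ) :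
    Real.sin (interiorAngle κ) = Real.sin (2 * Real.pi / κ) := by
  rw [interiorAngle_eq hκ, Real.sin_pi_sub]

lemma cos_interiorAngle (hκ : 3 ≤ κ) :
    Real.cos (interiorAngle κ) = -Real.cos (2 * Real.pi / κ) := by
  rw [interiorAngle_eq hκ, Real.cos_pi_sub]

/-- The centre in polar form: it is at distance `r / (2 sin (π/κ))` from the vertex `0`. -/
lemma polyCenter_eq (hκ : 3 ≤ κ) : polyCenter κ =
    (sideLength κ / (2 * Real.sin (Real.pi / κ))) •
      (⟨Real.sin (Real.pi / κ), Real.cos (Real.pi / κ)⟩ : ℂ) := by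
  have := (sin_half_step_pos hκ).ne'
  have := (cos_half_step_pos hκ).ne'
  apply Complex.ext
  · simp only [polyCenter, Complex.smul_re, smul_eq_mul]; field_simp
  · simp only [polyCenter, apothem, Real.tan_eq_sin_div_cos, Complex.smul_im, smul_eq_mul]
    field_simp

lemma polyCenter_ne_zero (hκ : 3 ≤ κ) : polyCenter κ ≠ 0 := fun h => by
  have := congrArg Complex.im h
  simp [polyCenter, (apothem_pos hκ).ne'] at this

lemma polyCenter_mul_one_sub (hκ : 3 ≤ κ) :
    polyCenter κ * (1 - unitDir (2 * Real.pi / κ)) = sideLength κ := by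
  have hs := (sin_half_step_pos hκ).ne'
  have h : 2 * Real.pi / κ = 2 * (Real.pi / κ) := by ring
  rw [polyCenter_eq hκ, h, smul_mul_assoc]
  have h2 := Real.sin_sq_add_cos_sq (Real.pi / κ)
  apply Complex.ext
  · simp only [unitDir, Real.cos_two_mul, Real.sin_two_mul, Complex.smul_re, smul_eq_mul,
      Complex.mul_re, Complex.sub_re, Complex.sub_im, Complex.one_re, Complex.one_im,
      Complex.ofReal_re]
    field_simp
    ring
  · simp only [unitDir, Real.cos_two_mul, Real.sin_two_mul, Complex.smul_im, smul_eq_mul,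
      Complex.mul_im, Complex.sub_re, Complex.sub_im, Complex.one_re, Complex.one_im,
      Complex.ofReal_im]
    field_simp
    linear_combination (-2 * sideLength κ * Real.cos (Real.pi / κ)) * h2

lemma unitDir_sideAngle_succ (κ j : ℕ) :
    unitDir (sideAngle κ (j + 1)) = unitDir (sideAngle κ j) * unitDir (2 * Real.pi / κ) := by
  rw [sideAngle_succ, unitDir_add]

lemma polyVertex_succ (κ m : ℕ) : polyVertex κ (m + 1) =
    polyVertex κ m + sideLength κ * unitDir (sideAngle κ m) := by
  rw [polyVertex, Finset.sum_range_succ, ← polyVertex, unitDir_eq_exp, sideAngle]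

lemma polyVertex_eq (hκ : 3 ≤ κ) (m : ℕ) :
    polyVertex κ m = polyCenter κ - polyCenter κ * unitDir (sideAngle κ m) := by
  induction m with
  | zero =>
    have : unitDir 0 = 1 := by apply Complex.ext <;> simp [unitDir]
    simp [polyVertex, sideAngle_zero, this]
  | succ m ih =>
    rw [polyVertex_succ, ih, unitDir_sideAngle_succ, ← polyCenter_mul_one_sub hκ]; ring

lemma sideHeight_polyVertex (hκ : 3 ≤ κ) (j : ℕ) : sideHeight κ j (polyVertex κ j) = 0 := by
  rw [sideHeight, polyVertex_eq hκ, sub_sub_cancel_left, map_neg, height_mul_unitDir, sub_self,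
    height_zero_apply]
  simp [polyCenter]

lemma mem_sideLine_iff (hκ : 3 ≤ κ) (j : Fin κ) (z : ℂ) :
    z ∈ sideLine κ j ↔ sideHeight κ j z = 0 := by
  rw [sideLine, mem_affineSpan_pair_iff_exists_lineMap_eq]
  have hr := (sideLength_pos hκ).ne'
  have key : ∀ t : ℝ, AffineMap.lineMap (polyVertex κ j) (polyVertex κ (j + 1)) t =
      polyVertex κ j + (t * sideLength κ : ℝ) • unitDir (sideAngle κ j) := by
    intro t
    rw [AffineMap.lineMap_apply, polyVertex_succ]
    simp [mul_assoc]; ring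
  have h0 := sideHeight_sub κ j z (polyVertex κ j)
  rw [sideHeight_polyVertex hκ, sub_zero] at h0
  constructor
  · rintro ⟨t, rfl⟩
    rw [h0, key, add_sub_cancel_left, map_smul]
    simp [height_apply, unitDir]; right; ring
  · intro h
    rw [h] at h0
    have h1 := eq_smul_unitDir_of_height_eq_zero h0.symm
    refine ⟨(Real.cos (sideAngle κ j) * (z - polyVertex κ j).re +
      Real.sin (sideAngle κ j) * (z - polyVertex κ j).im) / sideLength κ, ?_⟩
    rw [key, div_mul_cancel₀ _ hr, ← h1]; ring

lemma infDist_sideLine (hκ : 3 ≤ κ) (j : Fin κ) (z : ℂ) :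
    Metric.infDist z (sideLine κ j : Set ℂ) = |sideHeight κ j z| := by
  have hne : (sideLine κ j : Set ℂ).Nonempty :=
    ⟨polyVertex κ j, (mem_sideLine_iff hκ j _).2 (sideHeight_polyVertex hκ _)⟩
  apply le_antisymm
  · -- the foot of the perpendicular from `z`
    have hd := sideHeight_sub κ j (z - sideHeight κ j z • (Complex.I * unitDir (sideAngle κ j))) z
    rw [sub_sub_cancel_left, map_neg, map_smul, height_mul_unitDir, sub_self, height_zero_apply] at hd
    have hmem : z - sideHeight κ j z • (Complex.I * unitDir (sideAngle κ j)) ∈ sideLine κ j := by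
      rw [mem_sideLine_iff hκ]; simp at hd; simpa using hd
    refine (Metric.infDist_le_dist_of_mem hmem).trans_eq ?_
    rw [dist_eq_norm, sub_sub_cancel, norm_smul, norm_mul, norm_unitDir]
    simp
  · rw [Metric.le_infDist hne]
    intro y hy
    have hy0 := (mem_sideLine_iff hκ j y).1 hy
    have hd := sideHeight_sub κ j z y
    rw [hy0, sub_zero] at hd
    rw [hd, dist_eq_norm]
    exact abs_height_le_norm _ _

lemma finRotate_val_cases (hκ : 3 ≤ κ) (j : Fin κ) :
    (j : ℕ) + 1 < κ ∧ ((finRotate κ j : Fin κ) : ℕ) = j + 1 ∨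
      (j : ℕ) + 1 = κ ∧ ((finRotate κ j : Fin κ) : ℕ) = 0 := by
  obtain ⟨k, rfl⟩ : ∃ k, κ = k + 1 := ⟨κ - 1, by omega⟩
  by_cases h : j = Fin.last k
  · subst h; right; simp
  · left
    have := coe_finRotate_of_ne_last h
    have h' : (j : ℕ) ≠ k := fun h' => h (Fin.ext h')
    omega

/-- Turning from one side to the next one adds `2π/κ` to the direction, also from the last side
to the first one. -/
lemma height_finRotate (hκ : 3 ≤ κ) (j : Fin κ) :
    height (sideAngle κ (finRotate κ j : Fin κ)) = height (sideAngle κ j + 2 * Real.pi / κ) := by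
  rcases finRotate_val_cases hκ j with ⟨_, h⟩ | ⟨h1, h⟩
  · rw [h, sideAngle_succ]
  · rw [h, ← sideAngle_succ, h1, sideAngle_self hκ, sideAngle_zero, ← zero_add (2 * Real.pi),
      height_add_two_pi]

/-- The relation between the signed distances to three consecutive sides. -/
lemma sideHeight_prev_add_next (hκ : 3 ≤ κ) (j : Fin κ) (z : ℂ) :
    sideHeight κ ((finRotate κ).symm j : Fin κ) z + sideHeight κ (finRotate κ j : Fin κ) z
      = 2 * Real.cos (2 * Real.pi / κ) * sideHeight κ j z
        + sideLength κ * Real.sin (2 * Real.pi / κ) := by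
  have h1 := height_finRotate hκ ((finRotate κ).symm j)
  rw [Equiv.apply_symm_apply] at h1
  have hprev : height (sideAngle κ ((finRotate κ).symm j : Fin κ)) =
      height (sideAngle κ j - 2 * Real.pi / κ) := by
    ext w
    have e : ∀ w : ℂ, height (sideAngle κ ((finRotate κ).symm j : Fin κ)) w =
      height (sideAngle κ j) (w * unitDir (2 * Real.pi / κ)) := by
      intro w
      rw [h1, height_mul_unitDir]; congr 2; ring
    rw [e, height_mul_unitDir]
  rw [sideHeight, sideHeight, sideHeight, hprev, height_finRotate hκ]
  have h2 := height_add_add_height_sub (sideAngle κ j) (2 * Real.pi / κ) (z - polyCenter κ)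
  have hc : 2 * apothem κ = 2 * Real.cos (2 * Real.pi / κ) * apothem κ +
      sideLength κ * Real.sin (2 * Real.pi / κ) := by
    have h : 2 * Real.pi / κ = 2 * (Real.pi / κ) := by ring
    have hs := (sin_half_step_pos hκ).ne'
    have hcs := (cos_half_step_pos hκ).ne'
    have h2 := Real.sin_sq_add_cos_sq (Real.pi / κ)
    rw [h, Real.cos_two_mul, Real.sin_two_mul, apothem, Real.tan_eq_sin_div_cos]
    field_simp
    linear_combination (-2 * sideLength κ) * h2
  linear_combination h2 + hc

end Regular

/-! ### Closed polygons whose edges are sorted by angle -/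

lemma lt_of_forall_lt_succ {f : ℕ → ℝ} {a b : ℕ} (hab : a < b)
    (h : ∀ k, a ≤ k → k < b → f k < f (k + 1)) : f a < f b := by
  induction b, hab using Nat.le_induction with
  | base => exact h a le_rfl (Nat.lt_succ_self a)
  | succ b hb ih =>
    exact (ih fun k h1 h2 => h k h1 (h2.trans (Nat.lt_succ_self b))).trans
      (h b (by omega) (Nat.lt_succ_self b))

/-- A cyclic sequence whose `k`-th increment has the sign of `sin (θ k - α)`, for a nondecreasing
`θ`, attains its minimum only where `θ` passes `α`: from there the increments are first positive,
then negative, and they sum to zero. -/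
lemma lt_of_increment_sin {f θ : ℕ → ℝ} {n m : ℕ} {α : ℝ} (h0 : f n = f 0) (hmn : m ≤ n)
    (hα0 : 0 ≤ α) (hα : α ≤ 2 * Real.pi) (hθ : ∀ k < n, 0 ≤ θ k ∧ θ k < 2 * Real.pi)
    (hmono : ∀ i j, i ≤ j → j < n → θ i ≤ θ j)
    (hstep : ∀ k < n, ∃ ρ : ℝ, 0 ≤ ρ ∧ f (k + 1) - f k = ρ * Real.sin (θ k - α))
    (hne : ∀ k < n, f (k + 1) ≠ f k) (h1 : ∀ k < m, θ k ≤ α) (h2 : ∀ k, m ≤ k → k < n → α ≤ θ k)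
    {k : ℕ} (hk : k < n) (hkm : k ≠ m % n) : f m < f k := by
  have pos : ∀ k < n, 0 ≤ Real.sin (θ k - α) → f k < f (k + 1) := by
    intro k hk hs
    obtain ⟨ρ, hρ, e⟩ := hstep k hk
    have := mul_nonneg hρ hs
    exact lt_of_le_of_ne (by linarith) (hne k hk).symm
  have neg : ∀ k < n, Real.sin (θ k - α) ≤ 0 → (fun i => - f i) k < (fun i => - f i) (k + 1) := by
    intro k hk hs
    obtain ⟨ρ, hρ, e⟩ := hstep k hk
    have := mul_nonpos_of_nonneg_of_nonpos hρ hs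
    have := lt_of_le_of_ne (show f (k + 1) ≤ f k by linarith) (hne k hk)
    simpa using this
  have sinpos2 : ∀ x : ℝ, x ≤ -Real.pi → -(2 * Real.pi) ≤ x → 0 ≤ Real.sin x := by
    intro x hx hx'
    rw [← Real.sin_add_two_pi]
    exact Real.sin_nonneg_of_nonneg_of_le_pi (by linarith) (by linarith)
  have sinneg2 : ∀ x : ℝ, Real.pi ≤ x → x ≤ 2 * Real.pi → Real.sin x ≤ 0 := by
    intro x hx hx'
    rw [← Real.sin_sub_two_pi]
    exact Real.sin_nonpos_of_nonpos_of_neg_pi_le (by linarith) (by linarith)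
  have hπ := Real.pi_pos
  rcases le_or_gt α Real.pi with hαπ | hαπ
  · have negm : ∀ k < m, (fun i => - f i) k < (fun i => - f i) (k + 1) := fun k hk =>
      neg k (by omega) (Real.sin_nonpos_of_nonpos_of_neg_pi_le (by linarith [h1 k hk])
        (by linarith [(hθ k (by omega)).1]))
    rcases lt_or_ge k m with hlt | hge
    · have := lt_of_forall_lt_succ hlt fun i _ hi => negm i hi
      simpa using this
    · have hmk : m < k := by
        rcases hge.lt_or_eq with h | h
        · exact h
        · subst h; rw [Nat.mod_eq_of_lt hk] at hkm; exact absurd rfl hkm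
      rcases le_or_gt (θ (k - 1)) (α + Real.pi) with hc | hc
      · refine lt_of_forall_lt_succ hmk fun i hi hik => pos i (by omega) ?_
        exact Real.sin_nonneg_of_nonneg_of_le_pi (by linarith [h2 i hi (by omega)])
          (by linarith [hmono i (k - 1) (by omega) (by omega)])
      · have hlast := lt_of_forall_lt_succ hk fun i hi hin => neg i hin
          (sinneg2 _ (by linarith [hmono (k - 1) i (by omega) (by omega)])
            (by linarith [(hθ i hin).2]))
        have hlast' : f 0 < f k := by rw [← h0]; simpa using hlast
        rcases Nat.eq_zero_or_pos m with hm | hm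
        · rwa [hm]
        · have := lt_of_forall_lt_succ hm fun i _ hi => negm i hi
          have : f m < f 0 := by simpa using this
          linarith
  · have posm : ∀ k, m ≤ k → k < n → f k < f (k + 1) := fun k hk hkn =>
      pos k hkn (Real.sin_nonneg_of_nonneg_of_le_pi (by linarith [h2 k hk hkn])
        (by linarith [(hθ k hkn).2]))
    rcases lt_or_ge k m with hlt | hge
    · rcases le_or_gt (α - Real.pi) (θ k) with hc | hc
      · have := lt_of_forall_lt_succ hlt fun i hi him => neg i (by omega)
          (Real.sin_nonpos_of_nonpos_of_neg_pi_le (by linarith [h1 i him])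
            (by linarith [hmono k i hi (by omega)]))
        simpa using this
      · have hk0 : 0 < k → f 0 < f k := fun h => lt_of_forall_lt_succ h fun i _ hi =>
          pos i (by omega) (sinpos2 _ (by linarith [hmono i k (by omega) hk])
            (by linarith [(hθ i (by omega)).1]))
        have hmn' : m < n → f m < f 0 := fun h => by
          rw [← h0]; exact lt_of_forall_lt_succ h posm
        rcases hmn.lt_or_eq with h | h
        · rcases Nat.eq_zero_or_pos k with h' | h'
          · rw [h']; exact hmn' h
          · exact (hmn' h).trans (hk0 h')
        · have hk' : 0 < k := by
            rw [h, Nat.mod_self] at hkm; omega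
          rw [h, h0]; exact hk0 hk'
    · have hmk : m < k := by
        rcases hge.lt_or_eq with h | h
        · exact h
        · subst h; rw [Nat.mod_eq_of_lt hk] at hkm; exact absurd rfl hkm
      exact lt_of_forall_lt_succ hmk fun i hi hik => posm i hi (by omega)

section Points

variable {κ n : ℕ}

/-- The `i`-th edge of the closed polygon with vertices `z`. -/
def edge (z : Fin n → ℂ) (i : Fin n) : ℂ := z (finRotate n i) - z i

lemma finRotate_eq_ofNat [NeZero n] (i : Fin n) : finRotate n i = Fin.ofNat n (i + 1) := by
  rw [finRotate_apply]
  apply Fin.ext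
  simp [Fin.val_add]

lemma ofNat_val_self [NeZero n] (i : Fin n) : Fin.ofNat n (i : ℕ) = i :=
  Fin.ext (Nat.mod_eq_of_lt i.2)

lemma finRotate_ne_self (hn : 2 ≤ n) (i : Fin n) : finRotate n i ≠ i := by
  have : NeZero n := ⟨by omega⟩
  rw [finRotate_eq_ofNat]
  intro h
  have h := congrArg Fin.val h
  have hi := i.2
  simp only [Fin.val_ofNat] at h
  rcases Nat.lt_or_ge (i + 1) n with h1 | h1
  · rw [Nat.mod_eq_of_lt h1] at h; omega
  · rw [show (i : ℕ) + 1 = n by omega, Nat.mod_self] at h; omega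

/-- In a closed polygon with edges sorted by angle, the vertex at which the angles pass `α` is the
only lowest one with respect to the direction `α`. -/
lemma height_lt_of_monotone [NeZero n] {z : Fin n → ℂ} {α : ℝ} {m : ℕ} (hα0 : 0 ≤ α)
    (hα : α ≤ 2 * Real.pi) (hmono : Monotone fun i => planeAngle (edge z i))
    (hne : ∀ i, height α (edge z i) ≠ 0) (hmn : m ≤ n)
    (h1 : ∀ i : Fin n, (i : ℕ) < m → planeAngle (edge z i) ≤ α)
    (h2 : ∀ i : Fin n, m ≤ i → α ≤ planeAngle (edge z i)) {i : Fin n} (hi : i ≠ Fin.ofNat n m) :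
    height α (z (Fin.ofNat n m)) < height α (z i) := by
  have hstep : ∀ k < n, height α (z (Fin.ofNat n (k + 1))) - height α (z (Fin.ofNat n k)) =
      height α (edge z (Fin.ofNat n k)) := by
    intro k hk
    rw [edge, map_sub, finRotate_eq_ofNat, Fin.val_ofNat, Nat.mod_eq_of_lt hk]
  have := lt_of_increment_sin (f := fun k => height α (z (Fin.ofNat n k)))
    (θ := fun k => planeAngle (edge z (Fin.ofNat n k))) (n := n) (m := m) (α := α) (k := i)
    (by congr 2; apply Fin.ext; simp) hmn hα0 hα (fun k _ => planeAngle_mem _)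
    (fun a b hab hb => hmono (by
      rw [Fin.le_def, Fin.val_ofNat, Fin.val_ofNat, Nat.mod_eq_of_lt hb,
        Nat.mod_eq_of_lt (by omega)]; exact hab))
    (fun k hk => ⟨_, norm_nonneg _, by rw [hstep k hk, height_eq_norm_mul_sin]⟩)
    (fun k hk h => hne (Fin.ofNat n k) (by rw [← hstep k hk, sub_eq_zero]; exact h))
    (fun k hk => by
      rcases lt_or_ge k n with hkn | hkn
      · exact h1 _ (by rw [Fin.val_ofNat, Nat.mod_eq_of_lt hkn]; exact hk)
      · omega)
    (fun k hk hkn => h2 _ (by rw [Fin.val_ofNat, Nat.mod_eq_of_lt hkn]; exact hk))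
    i.2 (fun h => hi (Fin.ext (by simpa using h)))
  simpa [ofNat_val_self] using this

/-- No two of the points `z` are at the same distance of a side of the polygon. Almost every tuple
has this property. -/
def Generic (κ : ℕ) (z : Fin n → ℂ) : Prop :=
  ∀ (j : Fin κ) (i k : Fin n), i ≠ k → height (sideAngle κ j) (z i - z k) ≠ 0

lemma Generic.height_edge_ne {z : Fin n → ℂ} (h : Generic κ z) (hn : 2 ≤ n) (j : Fin κ)
    (i : Fin n) : height (sideAngle κ j) (edge z i) ≠ 0 :=
  h j _ _ (finRotate_ne_self hn i)

/-- The angles of the edges pass the direction of the `j`-th side at the index `m j`. -/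
def Splits (κ : ℕ) (z : Fin n → ℂ) (m : ℕ → ℕ) : Prop :=
  ∀ j : Fin κ, m j ≤ n ∧ (∀ i : Fin n, (i : ℕ) < m j → planeAngle (edge z i) ≤ sideAngle κ j) ∧
    ∀ i : Fin n, m j ≤ i → sideAngle κ j ≤ planeAngle (edge z i)

lemma sideHeight_lt_of_splits [NeZero n] (hκ : 3 ≤ κ) (hn : 2 ≤ n) {z : Fin n → ℂ}
    (hz : Generic κ z) (hmono : Monotone fun i => planeAngle (edge z i)) {m : ℕ → ℕ}
    (hm : Splits κ z m) (j : Fin κ) {i : Fin n} (hi : i ≠ Fin.ofNat n (m j)) :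
    sideHeight κ j (z (Fin.ofNat n (m j))) < sideHeight κ j (z i) := by
  have h := height_lt_of_monotone (sideAngle_nonneg κ j) (sideAngle_lt_two_pi hκ j.2).le hmono
    (hz.height_edge_ne hn j) (hm j).1 (hm j).2.1 (hm j).2.2 hi
  have h2 := sideHeight_sub κ j (z i) (z (Fin.ofNat n (m j)))
  rw [map_sub] at h2
  linarith

lemma sideDist_eq_of_splits [NeZero n] (hκ : 3 ≤ κ) (hn : 2 ≤ n) {z : Fin n → ℂ}
    (hz : Generic κ z) (hmono : Monotone fun i => planeAngle (edge z i)) {m : ℕ → ℕ}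
    (hm : Splits κ z m) (j : Fin κ) (hpos : ∀ i, 0 ≤ sideHeight κ j (z i)) :
    sideDist κ z j = sideHeight κ j (z (Fin.ofNat n (m j))) := by
  have e : ∀ i, Metric.infDist (z i) (sideLine κ j : Set ℂ) = sideHeight κ j (z i) := fun i => by
    rw [infDist_sideLine hκ, abs_of_nonneg (hpos i)]
  rw [sideDist]
  simp only [e]
  apply le_antisymm
  · exact ciInf_le (Set.finite_range _).bddBelow _
  · refine le_ciInf fun i => ?_
    by_cases hi : i = Fin.ofNat n (m j)
    · rw [hi]
    · exact (sideHeight_lt_of_splits hκ hn hz hmono hm j hi).le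

lemma contactIndex_eq_of_splits [NeZero n] (hκ : 3 ≤ κ) (hn : 2 ≤ n) {z : Fin n → ℂ}
    (hz : Generic κ z) (hmono : Monotone fun i => planeAngle (edge z i)) {m : ℕ → ℕ}
    (hm : Splits κ z m) (j : Fin κ) (hpos : ∀ i, 0 ≤ sideHeight κ j (z i)) :
    contactIndex κ z j = m j % n := by
  have hon : ∀ i, OnECPSide κ z j i ↔ i = Fin.ofNat n (m j) := fun i => by
    rw [OnECPSide, sideDist_eq_of_splits hκ hn hz hmono hm j hpos, infDist_sideLine hκ,
      abs_of_nonneg (hpos i)]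
    constructor
    · intro h
      by_contra hi
      exact absurd h (sideHeight_lt_of_splits hκ hn hz hmono hm j hi).ne'
    · rintro rfl; rfl
  have hset : {k | ∃ hk : k < n, OnECPSide κ z j ⟨k, hk⟩ ∧
    ∀ i, OnECPSide κ z j i →
      (z ⟨k, hk⟩).re < (z i).re ∨ (z ⟨k, hk⟩).re = (z i).re ∧ (z ⟨k, hk⟩).im ≤ (z i).im} =
      {m j % n} := by
    ext k
    simp only [Set.mem_ofPred_eq, Set.mem_singleton_iff, hon]
    constructor
    · rintro ⟨hk, h, -⟩
      simpa using congrArg Fin.val h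
    · rintro rfl
      refine ⟨Nat.mod_lt _ (Nat.pos_of_ne_zero (NeZero.ne n)), rfl, ?_⟩
      rintro i rfl
      exact Or.inr ⟨rfl, le_rfl⟩
  rw [contactIndex, hset, csInf_singleton]

/-- When the angles pass the direction of the `j`-th side at the index `m j`, the `j`-th contact point
is the vertex of index `m j`, so that the sizes are the increments of `m`. -/
lemma sizeVector_eq_of_splits [NeZero n] (hκ : 3 ≤ κ) (hn : 2 ≤ n) {z : Fin n → ℂ}
    (hz : Generic κ z) (hmono : Monotone fun i => planeAngle (edge z i)) {m : ℕ → ℕ}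
    (hm : Splits κ z m) (h0 : m 0 = 0) (hmκ : m κ = n) (hmm : Monotone m) (j : Fin κ)
    (hpos : ∀ (j : Fin κ) i, 0 ≤ sideHeight κ j (z i)) :
    sizeVector κ z j = (m (j + 1) - m j) % n := by
  rw [sizeVector, contactIndex_eq_of_splits hκ hn hz hmono hm _ (hpos _),
    contactIndex_eq_of_splits hκ hn hz hmono hm _ (hpos _)]
  have hrot : m (finRotate κ j : Fin κ) % n = m (j + 1) % n := by
    rcases finRotate_val_cases hκ j with ⟨_, h⟩ | ⟨h1, h⟩
    · rw [h]
    · rw [h, h1, h0, hmκ]; simp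
  rw [hrot]
  have hle : m j ≤ m (j + 1) := hmm (Nat.le_succ _)
  have hle2 : m (j + 1) ≤ n := by rw [← hmκ]; exact hmm j.2
  rcases hle2.lt_or_eq with h | h
  · rw [Nat.mod_eq_of_lt h, Nat.mod_eq_of_lt (hle.trans_lt h),
      show m (j + 1) + n - m j = (m (j + 1) - m j) + n by omega, Nat.add_mod_right]
  · rw [h, Nat.mod_self, zero_add]
    rcases (hle.trans hle2).lt_or_eq with h' | h'
    · rw [Nat.mod_eq_of_lt h']
    · simp [h']

end Points

/-! ### Volumes of products of simplices -/

/-- The volume `c^m / m!` of the simplex of the points of `ℝ^m` with nonnegative coordinates of sum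
at most `c`; the simplex is empty if `c < 0`. -/
noncomputable def simplexVol (m : ℕ) (c : ℝ) : ENNReal :=
  if 0 ≤ c then ENNReal.ofReal (c ^ m / m !) else 0

@[fun_prop]
lemma measurable_simplexVol (m : ℕ) : Measurable (simplexVol m) := by
  unfold simplexVol
  exact Measurable.ite measurableSet_Ici (by fun_prop) measurable_const

lemma lintegral_simplexVol (m : ℕ) (c : ℝ) :
    ∫⁻ t in Set.Ici 0, simplexVol m (c - t) = simplexVol (m + 1) c := by
  rcases le_or_gt 0 c with hc | hc
  · have h1 : ∀ t, (Set.Ici (0 : ℝ)).indicator (fun t => simplexVol m (c - t)) t =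
        (Set.Icc 0 c).indicator (fun t => ENNReal.ofReal ((c - t) ^ m / m !)) t := by
      intro t
      by_cases h0 : 0 ≤ t <;> by_cases h1 : t ≤ c <;> simp [Set.indicator, simplexVol, h0, h1]
    rw [← lintegral_indicator measurableSet_Ici, lintegral_congr h1,
      lintegral_indicator measurableSet_Icc, ← ofReal_integral_eq_lintegral_ofReal]
    · rw [simplexVol, if_pos hc, integral_Icc_eq_integral_Ioc, ← intervalIntegral.integral_of_le hc,
        intervalIntegral.integral_div,
        intervalIntegral.integral_comp_sub_left (fun x => x ^ m), integral_pow]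
      congr 1
      have : (m ! : ℝ) ≠ 0 := by positivity
      rw [Nat.factorial_succ]
      push_cast
      field_simp
      simp
    · exact (Continuous.integrableOn_Icc (by fun_prop))
    · filter_upwards [ae_restrict_mem measurableSet_Icc] with t ht
      have : 0 ≤ c - t := by linarith [ht.2]
      positivity
  · rw [simplexVol, if_neg (not_le.2 hc)]
    rw [setLIntegral_congr_fun measurableSet_Ici (g := fun _ => 0)]
    · simp
    · intro t ht
      have : ¬ (0 ≤ c - t) := by
        have : (0 : ℝ) ≤ t := ht
        linarith
      simp only [simplexVol, if_neg this]

/-- The points with nonnegative coordinates such that, for each `j`, the coordinates of class `j`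
have sum at most `c j`: a product of simplices. -/
def simplexProd {ι J : Type*} [Fintype ι] [DecidableEq J] (f : ι → J) (c : J → ℝ) : Set (ι → ℝ) :=
  {w | (∀ e, 0 ≤ w e) ∧ ∀ j, ∑ e with f e = j, w e ≤ c j}

lemma measurableSet_simplexProd {ι J : Type*} [Fintype ι] [DecidableEq J] (f : ι → J)
    (c : J → ℝ) : MeasurableSet (simplexProd f c) := by
  apply IsClosed.measurableSet
  rw [simplexProd, Set.ofPred_and, Set.ofPred_forall, Set.ofPred_forall]
  refine (isClosed_iInter fun e => isClosed_le (by fun_prop) (by fun_prop)).inter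
    (isClosed_iInter fun j => isClosed_le (by fun_prop) (by fun_prop))

lemma volume_simplexProd_fin {J : Type*} [Fintype J] [DecidableEq J] {N : ℕ} (f : Fin N → J)
    (c : J → ℝ) : volume (simplexProd f c) =
      ∏ j, simplexVol (Finset.univ.filter fun e => f e = j).card (c j) := by
  induction N generalizing c with
  | zero =>
    simp only [Finset.univ_eq_empty, Finset.filter_empty, Finset.card_empty, simplexVol,
      pow_zero, Nat.factorial_zero, Nat.cast_one, div_one, ENNReal.ofReal_one]
    by_cases h : ∀ j, 0 ≤ c j
    · have : simplexProd f c = Set.univ := by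
        ext w; simp [simplexProd, h]
      rw [this, Finset.prod_congr rfl fun j _ => if_pos (h j)]
      simp [volume_pi]
    · have : simplexProd f c = ∅ := by
        ext w; simpa [simplexProd] using h
      push Not at h
      obtain ⟨j, hj⟩ := h
      rw [this, Finset.prod_eq_zero (Finset.mem_univ j) (if_neg (not_le.2 hj)), measure_empty]
  | succ N ih =>
    have hmp := (volume_preserving_piFinSuccAbove (fun _ : Fin (N + 1) => ℝ) 0).symm
    rw [← hmp.measure_preimage (measurableSet_simplexProd f c).nullMeasurableSet, Measure.volume_eq_prod,
      Measure.prod_apply (hmp.measurable (measurableSet_simplexProd f c))]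
    -- fixing the first coordinate `t` leaves a product of simplices in which that of its class has
    -- shrunk by `t`
    have key : ∀ t : ℝ, volume (Prod.mk t ⁻¹' ((MeasurableEquiv.piFinSuccAbove
        (fun _ : Fin (N + 1) => ℝ) 0).symm ⁻¹' simplexProd f c)) = (Set.Ici 0).indicator (fun t =>
          (∏ j ∈ Finset.univ.erase (f 0), simplexVol
            (Finset.univ.filter fun e : Fin N => f e.succ = j).card (c j)) *
          simplexVol (Finset.univ.filter fun e : Fin N => f e.succ = f 0).card (c (f 0) - t)) t := by
      intro t
      by_cases ht : 0 ≤ t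
      · rw [Set.indicator_of_mem (show t ∈ Set.Ici (0 : ℝ) from ht)]
        have hset : Prod.mk t ⁻¹' ((MeasurableEquiv.piFinSuccAbove
            (fun _ : Fin (N + 1) => ℝ) 0).symm ⁻¹' simplexProd f c) =
            simplexProd (fun e => f e.succ) (fun j => if j = f 0 then c j - t else c j) := by
          ext w
          simp only [simplexProd, Set.mem_preimage, Set.mem_ofPred_eq, Fin.forall_fin_succ,
            Finset.sum_filter, Fin.sum_univ_succ]
          simp only [MeasurableEquiv.piFinSuccAbove_symm_apply, Fin.insertNthEquiv_apply,
            Fin.insertNth_zero', Fin.cons_zero, Fin.cons_succ, ht, true_and]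
          refine and_congr_right fun _ => forall_congr' fun j => ?_
          by_cases hj : j = f 0
          · subst hj; simp only [if_true]; constructor <;> intro h <;> linarith
          · simp [hj, Ne.symm hj]
        rw [hset, ih, ← Finset.prod_erase_mul _ _ (Finset.mem_univ (f 0)), if_pos rfl]
        congr 1
        exact Finset.prod_congr rfl fun j hj => by rw [if_neg (Finset.ne_of_mem_erase hj)]
      · rw [Set.indicator_of_notMem (show t ∉ Set.Ici (0 : ℝ) from ht)]
        convert measure_empty (μ := volume)
        ext w
        simp only [simplexProd, Set.mem_preimage, Set.mem_ofPred_eq, Fin.forall_fin_succ,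
          MeasurableEquiv.piFinSuccAbove_symm_apply, Fin.insertNthEquiv_apply,
            Fin.insertNth_zero', Fin.cons_zero]
        simp [ht]
    rw [lintegral_congr key, lintegral_indicator measurableSet_Ici, lintegral_const_mul _ (by fun_prop),
      lintegral_simplexVol, ← Finset.prod_erase_mul _ _ (Finset.mem_univ (f 0))]
    congr 1
    · refine Finset.prod_congr rfl fun j hj => ?_
      rw [Fin.univ_succ, Finset.filter_cons, if_neg (Finset.ne_of_mem_erase hj).symm,
        Finset.filter_map, Finset.card_map]
      rfl
    · rw [Fin.univ_succ, Finset.filter_cons, if_pos rfl, Finset.card_cons,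
        Finset.filter_map, Finset.card_map]
      rfl

lemma volume_simplexProd {ι J : Type*} [Fintype ι] [Fintype J] [DecidableEq J] (f : ι → J)
    (c : J → ℝ) : volume (simplexProd f c) =
      ∏ j, simplexVol (Finset.univ.filter fun e => f e = j).card (c j) := by
  let g := (Fintype.equivFin ι).symm
  have hmp := volume_measurePreserving_piCongrLeft (fun _ : ι => ℝ) g
  rw [← hmp.measure_preimage (measurableSet_simplexProd f c).nullMeasurableSet]
  have : (MeasurableEquiv.piCongrLeft (fun _ : ι => ℝ) g) ⁻¹' simplexProd f c =
      simplexProd (f ∘ g) c := by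
    ext w
    have hw : ∀ i, (MeasurableEquiv.piCongrLeft (fun _ : ι => ℝ) g) w (g i) = w i := fun i =>
      Equiv.piCongrLeft_apply_apply (fun _ : ι => ℝ) g w i
    simp only [simplexProd, Set.mem_preimage, Set.mem_ofPred_eq, ← g.forall_congr_right, hw,
      Finset.sum_filter, ← g.sum_comp, Function.comp_apply]
  rw [this, volume_simplexProd_fin]
  refine Finset.prod_congr rfl fun j _ => ?_
  congr 1
  refine Finset.card_bij (fun e _ => g e) (by simp) (by simp) fun b hb => ⟨g.symm b, by simpa using hb⟩

/-! ### The regular polygon is an intersection of half-planes and has area one -/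

/-- The linear map of `ℂ` whose coordinates are two heights. -/
noncomputable def heightPair (α β : ℝ) : ℂ →ₗ[ℝ] ℂ :=
  LinearMap.toSpanSingleton ℝ ℂ 1 ∘ₗ height α + LinearMap.toSpanSingleton ℝ ℂ Complex.I ∘ₗ height β

lemma heightPair_re (α β : ℝ) (w : ℂ) : (heightPair α β w).re = height α w := by
  simp [heightPair]

lemma heightPair_im (α β : ℝ) (w : ℂ) : (heightPair α β w).im = height β w := by
  simp [heightPair]

lemma det_heightPair (α β : ℝ) : LinearMap.det (heightPair α β) = Real.sin (β - α) := by
  rw [← LinearMap.det_toMatrix Complex.basisOneI, Matrix.det_fin_two]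
  simp only [LinearMap.toMatrix_apply, Complex.coe_basisOneI, Complex.coe_basisOneI_repr,
    Matrix.cons_val_zero, Matrix.cons_val_one, heightPair_re, heightPair_im, height_apply,
    Real.sin_sub]
  simp
  ring

lemma volume_triangle {c : ℝ} (hc : 0 ≤ c) :
    volume {p : ℂ | 0 ≤ p.re ∧ 0 ≤ p.im ∧ p.re + p.im ≤ c} = ENNReal.ofReal (c ^ 2 / 2) := by
  have h := volume_simplexProd (fun _ : Fin 2 => ()) (fun _ => c)
  rw [← Complex.volume_preserving_equiv_pi.measure_preimage
    (measurableSet_simplexProd _ _).nullMeasurableSet] at h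
  have hset : (Complex.measurableEquivPi ⁻¹' simplexProd (fun _ : Fin 2 => ()) (fun _ => c)) =
      {p : ℂ | 0 ≤ p.re ∧ 0 ≤ p.im ∧ p.re + p.im ≤ c} := by
    ext p
    simp [simplexProd, Complex.measurableEquivPi_apply, Fin.forall_fin_two, and_assoc]
  rw [← hset, h]
  simp [simplexVol, hc]

lemma volume_sector_triangle {γ δ c : ℝ} (hδ : 0 < Real.sin δ) (hc : 0 ≤ c) :
    volume {w : ℂ | 0 ≤ height γ w ∧ height (γ + δ) w ≤ 0 ∧ height γ w - height (γ + δ) w ≤ c} =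
      ENNReal.ofReal (c ^ 2 / (2 * Real.sin δ)) := by
  have hneg : ∀ w, height (γ + δ + Real.pi) w = - height (γ + δ) w := fun w => by
    simp [height_apply, Real.cos_add_pi, Real.sin_add_pi]; ring
  have hdet : LinearMap.det (heightPair γ (γ + δ + Real.pi)) = - Real.sin δ := by
    rw [det_heightPair, show γ + δ + Real.pi - γ = δ + Real.pi by ring, Real.sin_add_pi]
  have := Measure.addHaar_preimage_linearMap volume (f := heightPair γ (γ + δ + Real.pi))
    (by rw [hdet]; linarith) {p : ℂ | 0 ≤ p.re ∧ 0 ≤ p.im ∧ p.re + p.im ≤ c}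
  rw [volume_triangle hc, hdet, ← ENNReal.ofReal_mul (abs_nonneg _)] at this
  convert this using 2
  · ext w
    simp only [Set.mem_preimage, Set.mem_ofPred_eq, heightPair_re, heightPair_im, hneg,
      ← sub_eq_add_neg, neg_nonneg]
  · rw [abs_inv, abs_neg, abs_of_pos hδ]; field_simp

/-- Coordinates in the basis of two directions. -/
lemma sin_smul_eq (α δ : ℝ) (v : ℂ) : Real.sin δ • v =
    (- height (α + δ) v) • unitDir α + height α v • unitDir (α + δ) := by
  have h2 := Real.sin_sq_add_cos_sq α
  apply Complex.ext
  · simp only [Complex.smul_re, Complex.add_re, unitDir, height_apply, Real.cos_add, Real.sin_add,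
      smul_eq_mul]
    linear_combination (-Real.sin δ * v.re) * h2
  · simp only [Complex.smul_im, Complex.add_im, unitDir, height_apply, Real.cos_add, Real.sin_add,
      smul_eq_mul]
    linear_combination (-Real.sin δ * v.im) * h2

lemma ae_height_ne_zero (α : ℝ) : ∀ᵐ v : ℂ, height α v ≠ 0 := by
  have h := Measure.addHaar_submodule volume (LinearMap.ker (height α)) (by
    intro h
    have : Complex.I * unitDir α ∈ LinearMap.ker (height α) := by rw [h]; trivial
    rw [LinearMap.mem_ker, height_mul_unitDir, sub_self, height_zero_apply] at this
    have h2 := Real.sin_sq_add_cos_sq α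
    simp at this)
  rw [← compl_mem_ae_iff] at h
  filter_upwards [h] with v hv
  simpa using hv

section Regular

variable {κ : ℕ}

/-- The polygon cuts the plane, seen from its centre, into `κ` sectors. -/
lemma exists_sector (hκ : 3 ≤ κ) (v : ℂ) :
    ∃ j : Fin κ, 0 ≤ height (sideAngle κ j) v ∧ height (sideAngle κ (j + 1)) v ≤ 0 := by
  have hκ0 : (0 : ℝ) < κ := by positivity
  have hπ := Real.pi_pos
  obtain ⟨h0, h1⟩ := planeAngle_mem v
  have hstep := step_lt_pi hκ
  set x := planeAngle v * κ / (2 * Real.pi) with hx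
  have hx0 : 0 ≤ x := by positivity
  have hxκ : x < κ := by
    rw [hx, div_lt_iff₀ (by positivity)]; nlinarith
  have hfl := Nat.floor_le hx0
  have hlt := Nat.lt_floor_add_one x
  have hα : sideAngle κ ⌊x⌋₊ ≤ planeAngle v := by
    rw [sideAngle, div_le_iff₀ hκ0]
    rw [hx, le_div_iff₀ (by positivity)] at hfl
    rw [hx]; linarith
  have hα' : planeAngle v ≤ sideAngle κ (⌊x⌋₊ + 1) := by
    rw [sideAngle, le_div_iff₀ hκ0]
    rw [hx, div_lt_iff₀ (by positivity)] at hlt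
    push_cast
    rw [hx]; linarith
  refine ⟨⟨⌊x⌋₊, (Nat.floor_lt hx0).2 hxκ⟩, ?_, ?_⟩
  · rw [height_eq_norm_mul_sin]
    refine mul_nonneg (norm_nonneg _) (Real.sin_nonneg_of_nonneg_of_le_pi (by simpa using hα) ?_)
    rw [sideAngle_succ] at hα'
    simp only; linarith
  · rw [height_eq_norm_mul_sin]
    refine mul_nonpos_of_nonneg_of_nonpos (norm_nonneg _)
      (Real.sin_nonpos_of_nonpos_of_neg_pi_le (by simpa using hα') ?_)
    simp only [sideAngle_succ] at hα' ⊢; linarith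

/-- In the open cone between the directions of two consecutive sides, the argument in `[0, 2π)`
lies between the two angles. -/
lemma planeAngle_mem_of_cone (hκ : 3 ≤ κ) {j : ℕ} (hj : j < κ) {v : ℂ}
    (h1 : 0 < height (sideAngle κ j) v) (h2 : height (sideAngle κ (j + 1)) v < 0) :
    sideAngle κ j < planeAngle v ∧ planeAngle v < sideAngle κ (j + 1) := by
  rw [height_eq_norm_mul_sin] at h1 h2
  have hv : 0 < ‖v‖ := by
    rcases (norm_nonneg v).eq_or_lt with h | h
    · rw [← h, zero_mul] at h1; exact absurd h1 (lt_irrefl 0)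
    · exact h
  have h1 : 0 < Real.sin (planeAngle v - sideAngle κ j) := pos_of_mul_pos_right h1 hv.le
  have h2 : Real.sin (planeAngle v - sideAngle κ (j + 1)) < 0 := by
    by_contra h; push Not at h; nlinarith
  obtain ⟨hφ0, hφ1⟩ := planeAngle_mem v
  have hα0 := sideAngle_nonneg κ j
  have hα1 : sideAngle κ (j + 1) ≤ 2 * Real.pi := by
    rw [← sideAngle_self hκ]; exact sideAngle_mono κ hj
  have hstep := step_lt_pi hκ
  have hstep0 := step_pos hκ
  rw [sideAngle_succ] at h2 hα1 ⊢
  set ψ := planeAngle v - sideAngle κ j with hψ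
  rw [show planeAngle v - (sideAngle κ j + 2 * Real.pi / κ) = ψ - 2 * Real.pi / κ by ring] at h2
  rcases le_or_gt ψ (-Real.pi) with hc | hc
  · exfalso
    rw [← Real.sin_add_two_pi] at h2
    have := Real.sin_nonneg_of_nonneg_of_le_pi
      (x := ψ - 2 * Real.pi / κ + 2 * Real.pi) (by linarith) (by linarith)
    linarith
  · have hψ0 : 0 < ψ := by
      by_contra h; push Not at h
      exact absurd (Real.sin_nonpos_of_nonpos_of_neg_pi_le h hc.le) (not_le.2 h1)
    have hψπ : ψ < Real.pi := by
      by_contra h; push Not at h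
      have : Real.sin ψ ≤ 0 := by
        rw [← Real.sin_sub_two_pi]
        exact Real.sin_nonpos_of_nonpos_of_neg_pi_le (by linarith) (by linarith)
      linarith
    refine ⟨by linarith, ?_⟩
    by_contra h; push Not at h
    exact absurd (Real.sin_nonneg_of_nonneg_of_le_pi (x := ψ - 2 * Real.pi / κ) (by linarith)
      (by linarith)) (not_le.2 h2)

lemma sideHeight_center_sub (κ j : ℕ) (v : ℂ) : sideHeight κ j (polyCenter κ - polyCenter κ * v) =
    apothem κ - height (sideAngle κ j) (polyCenter κ * v) := by
  rw [sideHeight, sub_sub_cancel_left, map_neg, sub_eq_add_neg]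

lemma height_center_mul (κ j : ℕ) :
    height (sideAngle κ j) (polyCenter κ * unitDir (sideAngle κ j)) = apothem κ := by
  rw [height_mul_unitDir, sub_self, height_zero_apply]; rfl

lemma height_center_mul_succ (hκ : 3 ≤ κ) (j : ℕ) :
    height (sideAngle κ j) (polyCenter κ * unitDir (sideAngle κ (j + 1))) = apothem κ := by
  have h := congrArg Complex.im (polyCenter_mul_one_sub hκ)
  rw [mul_sub, mul_one, Complex.sub_im, Complex.ofReal_im, sub_eq_zero] at h
  rw [unitDir_sideAngle_succ, mul_comm (unitDir _), ← mul_assoc, height_mul_unitDir, sub_self,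
    height_zero_apply, ← h]
  rfl

lemma sum_unitDir_eq_zero (hκ : 3 ≤ κ) : ∑ j : Fin κ, unitDir (sideAngle κ j) = 0 := by
  have h := polyVertex_eq hκ κ
  have h1 : unitDir (sideAngle κ κ) = 1 := by
    rw [sideAngle_self hκ]; apply Complex.ext <;> simp [unitDir]
  rw [h1, mul_one, sub_self, polyVertex, ← Finset.mul_sum] at h
  have hr : (sideLength κ : ℂ) ≠ 0 := by exact_mod_cast (sideLength_pos hκ).ne'
  rw [Fin.sum_univ_eq_sum_range (fun j => unitDir (sideAngle κ j))]
  rcases mul_eq_zero.1 h with h | h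
  · exact absurd h hr
  · rw [← h]; exact Finset.sum_congr rfl fun i _ => by rw [unitDir_eq_exp, sideAngle]

lemma polyVertex_mem (j : Fin κ) : polyVertex κ j ∈ regularPolygon κ :=
  subset_convexHull ℝ _ ⟨j, rfl⟩

lemma polyVertex_succ_mem (hκ : 3 ≤ κ) (j : Fin κ) : polyVertex κ (j + 1) ∈ regularPolygon κ := by
  rcases finRotate_val_cases hκ j with ⟨_, h⟩ | ⟨h1, h⟩
  · rw [← h]; exact polyVertex_mem _
  · have : polyVertex κ (j + 1) = polyVertex κ (finRotate κ j : Fin κ) := by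
      rw [polyVertex_eq hκ, polyVertex_eq hκ, h, h1, sideAngle_self hκ, sideAngle_zero]
      congr 2; apply Complex.ext <;> simp [unitDir]
    rw [this]; exact polyVertex_mem _

lemma polyCenter_mem (hκ : 3 ≤ κ) : polyCenter κ ∈ regularPolygon κ := by
  have hκ0 : (κ : ℝ) ≠ 0 := by positivity
  have h := (convex_convexHull ℝ (Set.range fun j : Fin κ => polyVertex κ j)).sum_mem
    (t := Finset.univ) (w := fun _ => (κ : ℝ)⁻¹) (z := fun j : Fin κ => polyVertex κ j)
    (fun _ _ => by positivity) (by simp [hκ0]) (fun j _ => polyVertex_mem j)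
  have e : ∑ j : Fin κ, (κ : ℝ)⁻¹ • polyVertex κ j = polyCenter κ := by
    rw [← Finset.smul_sum]
    simp only [polyVertex_eq hκ, Finset.sum_sub_distrib, ← Finset.mul_sum, sum_unitDir_eq_zero hκ,
      Finset.sum_const, Finset.card_univ, Fintype.card_fin, mul_zero, sub_zero]
    rw [← Nat.cast_smul_eq_nsmul ℝ, smul_smul, inv_mul_cancel₀ hκ0, one_smul]
  rw [e] at h
  exact h

lemma cos_le_cos_of_mem_Icc {a x : ℝ} (ha : 0 ≤ a) (h1 : a ≤ x) (h2 : x ≤ 2 * Real.pi - a) :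
    Real.cos x ≤ Real.cos a := by
  rcases le_total x Real.pi with h | h
  · exact Real.cos_le_cos_of_nonneg_of_le_pi ha h h1
  · rw [← Real.cos_two_pi_sub x]
    exact Real.cos_le_cos_of_nonneg_of_le_pi ha (by linarith) (by linarith)

lemma sideHeight_polyVertex_nonneg (hκ : 3 ≤ κ) (j m : Fin κ) :
    0 ≤ sideHeight κ j (polyVertex κ m) := by
  have hs := sin_half_step_pos hκ
  have hc := cos_half_step_pos hκ
  have hκ0 : (0 : ℝ) < κ := by positivity
  rw [polyVertex_eq hκ, sideHeight_center_sub, height_mul_unitDir, polyCenter_eq hκ, map_smul,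
    height_apply, smul_eq_mul]
  simp only
  set ψ := sideAngle κ j - sideAngle κ m with hψ
  have hcos : Real.cos (ψ + Real.pi / κ) ≤ Real.cos (Real.pi / κ) := by
    have hπ := Real.pi_pos
    have ha : 0 ≤ Real.pi / κ := by positivity
    have hjκ : (j : ℝ) + 1 ≤ κ := by exact_mod_cast j.2
    have hmκ : (m : ℝ) + 1 ≤ κ := by exact_mod_cast m.2
    have hj0 : (0 : ℝ) ≤ j := by positivity
    have hm0 : (0 : ℝ) ≤ m := by positivity
    have e : ψ + Real.pi / κ = (2 * (j - m) + 1) * (Real.pi / κ) := by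
      rw [hψ, sideAngle, sideAngle]; ring
    have e2 : 2 * Real.pi = (2 * κ) * (Real.pi / κ) := by field_simp
    rcases le_or_gt m j with h | h
    · have h' : (m : ℝ) ≤ j := by exact_mod_cast h
      refine cos_le_cos_of_mem_Icc ha ?_ ?_
      · rw [e]; nlinarith
      · rw [e, e2]; nlinarith
    · have h' : (j : ℝ) + 1 ≤ m := by exact_mod_cast h
      rw [← Real.cos_neg (ψ + _)]
      refine cos_le_cos_of_mem_Icc ha ?_ ?_
      · rw [e]; nlinarith
      · rw [e, e2]; nlinarith
  have hap : apothem κ = sideLength κ / (2 * Real.sin (Real.pi / κ)) * Real.cos (Real.pi / κ) := by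
    rw [apothem, Real.tan_eq_sin_div_cos]; field_simp
  rw [Real.cos_add] at hcos
  rw [hap, ← mul_sub]
  have := sideLength_pos hκ
  refine mul_nonneg (by positivity) (by linarith)

/-- In a sector, membership in the polygon is decided by one side. -/
lemma mem_regularPolygon_of_sector (hκ : 3 ≤ κ) (j : Fin κ) {v : ℂ}
    (h1 : 0 ≤ height (sideAngle κ j) v) (h2 : height (sideAngle κ (j + 1)) v ≤ 0)
    (h3 : height (sideAngle κ j) v - height (sideAngle κ (j + 1)) v ≤ Real.sin (2 * Real.pi / κ)) :
    polyCenter κ - polyCenter κ * v ∈ regularPolygon κ := by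
  have hs := sin_step_pos hκ
  have hv := sin_smul_eq (sideAngle κ j) (2 * Real.pi / κ) v
  rw [← sideAngle_succ] at hv
  set s := Real.sin (2 * Real.pi / κ) with hsdef
  set x := height (sideAngle κ j) v
  set y := height (sideAngle κ (j + 1)) v
  have hmem := (convex_convexHull ℝ (Set.range fun j : Fin κ => polyVertex κ j)).sum_mem
    (t := Finset.univ) (w := ![(s - (x - y)) / s, -y / s, x / s])
    (z := ![polyCenter κ, polyVertex κ j, polyVertex κ (j + 1)])
    (by
      intro i _
      fin_cases i
      · exact div_nonneg (by linarith) hs.le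
      · exact div_nonneg (by linarith) hs.le
      · exact div_nonneg h1 hs.le)
    (by simp [Fin.sum_univ_three]; field_simp; ring)
    (by
      intro i _
      fin_cases i
      · exact polyCenter_mem hκ
      · exact polyVertex_mem _
      · exact polyVertex_succ_mem hκ _)
  have hv' : v = (s : ℂ)⁻¹ * (-y * unitDir (sideAngle κ j) + x * unitDir (sideAngle κ (j + 1))) := by
    rw [eq_inv_mul_iff_mul_eq₀ (by exact_mod_cast hs.ne')]
    simpa using hv
  have hsC : (s : ℂ) ≠ 0 := by exact_mod_cast hs.ne'
  have e : polyCenter κ - polyCenter κ * v = ∑ i, ![(s - (x - y)) / s, -y / s, x / s] i •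
      ![polyCenter κ, polyVertex κ j, polyVertex κ (j + 1)] i := by
    simp only [Fin.sum_univ_three, Matrix.cons_val_zero, Matrix.cons_val_one, Matrix.cons_val,
      polyVertex_eq hκ, Complex.real_smul]
    rw [hv']
    push_cast
    field_simp
    ring
  rw [e]
  exact hmem

lemma sector_bound_of_sideHeight_nonneg (hκ : 3 ≤ κ) (j : ℕ) {v : ℂ}
    (h : 0 ≤ sideHeight κ j (polyCenter κ - polyCenter κ * v)) :
    height (sideAngle κ j) v - height (sideAngle κ (j + 1)) v ≤ Real.sin (2 * Real.pi / κ) := by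
  have hs := sin_step_pos hκ
  have hv := sin_smul_eq (sideAngle κ j) (2 * Real.pi / κ) v
  rw [← sideAngle_succ] at hv
  have h2 : Real.sin (2 * Real.pi / κ) * height (sideAngle κ j) (polyCenter κ * v) =
      (height (sideAngle κ j) v - height (sideAngle κ (j + 1)) v) * apothem κ := by
    rw [← smul_eq_mul, ← map_smul, ← mul_smul_comm, hv, mul_add, mul_smul_comm, mul_smul_comm,
      map_add, map_smul, map_smul, height_center_mul, height_center_mul_succ hκ, smul_eq_mul,
      smul_eq_mul]
    ring
  rw [sideHeight_center_sub] at h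
  have := apothem_pos hκ
  nlinarith

lemma mem_regularPolygon_iff (hκ : 3 ≤ κ) (z : ℂ) :
    z ∈ regularPolygon κ ↔ ∀ j : Fin κ, 0 ≤ sideHeight κ j z := by
  constructor
  · intro hz j
    have hconv : Convex ℝ {z : ℂ | 0 ≤ sideHeight κ j z} := by
      have h := convex_halfSpace_ge (𝕜 := ℝ) (f := height (sideAngle κ j)) (height _).isLinear
        (height (sideAngle κ j) (polyCenter κ) - apothem κ)
      have e : {z : ℂ | 0 ≤ sideHeight κ j z} = {w | height (sideAngle κ j) (polyCenter κ) -
          apothem κ ≤ height (sideAngle κ j) w} := by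
        ext z
        simp only [sideHeight, map_sub, Set.mem_ofPred_eq]
        constructor <;> intro h <;> linarith
      rw [e]
      exact h
    refine convexHull_min ?_ hconv hz
    rintro _ ⟨m, rfl⟩
    exact sideHeight_polyVertex_nonneg hκ j m
  · intro h
    have hc := polyCenter_ne_zero hκ
    obtain ⟨v, rfl⟩ : ∃ v, z = polyCenter κ - polyCenter κ * v :=
      ⟨1 - z / polyCenter κ, by field_simp; ring⟩
    obtain ⟨j, h1, h2⟩ := exists_sector hκ v
    exact mem_regularPolygon_of_sector hκ j h1 h2 (sector_bound_of_sideHeight_nonneg hκ j (h j))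

/-- The triangle with a vertex at the centre and the `j`-th side as opposite side, in the
coordinates where the centre is `0` and the vertex `0` of the polygon is `1`. -/
def sectorTriangle (κ j : ℕ) : Set ℂ :=
  {v | 0 ≤ height (sideAngle κ j) v ∧ height (sideAngle κ j + 2 * Real.pi / κ) v ≤ 0 ∧
    height (sideAngle κ j) v - height (sideAngle κ j + 2 * Real.pi / κ) v ≤
      Real.sin (2 * Real.pi / κ)}

lemma volume_sectorTriangle (hκ : 3 ≤ κ) (j : ℕ) : volume (sectorTriangle κ j) =
    ENNReal.ofReal (Real.sin (2 * Real.pi / κ) / 2) := by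
  have hs := sin_step_pos hκ
  rw [sectorTriangle, volume_sector_triangle hs hs.le]
  congr 1; field_simp

lemma measurableSet_sectorTriangle (κ j : ℕ) : MeasurableSet (sectorTriangle κ j) := by
  apply IsClosed.measurableSet
  rw [sectorTriangle, Set.ofPred_and, Set.ofPred_and]
  exact (isClosed_le (by fun_prop) (by fun_prop)).inter
    ((isClosed_le (by fun_prop) (by fun_prop)).inter (isClosed_le (by fun_prop) (by fun_prop)))

lemma volume_iUnion_sectorTriangle (hκ : 3 ≤ κ) : volume (⋃ j : Fin κ, sectorTriangle κ j) =
    ENNReal.ofReal (κ * (Real.sin (2 * Real.pi / κ) / 2)) := by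
  refine (measure_iUnion₀ ?_ fun j : Fin κ =>
    (measurableSet_sectorTriangle κ j).nullMeasurableSet).trans ?_
  rotate_left
  · simp only [volume_sectorTriangle hκ, tsum_fintype, Finset.sum_const, Finset.card_univ,
      Fintype.card_fin, nsmul_eq_mul]
    rw [ENNReal.ofReal_mul (by positivity), ENNReal.ofReal_natCast]
  · intro j k hjk
    have hae : ∀ᵐ v : ℂ, ∀ i : ℕ, height (sideAngle κ i) v ≠ 0 :=
      ae_all_iff.2 fun i => ae_height_ne_zero _
    refine measure_mono_null (t := {v | ¬ ∀ i : ℕ, height (sideAngle κ i) v ≠ 0}) ?_ hae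
    rintro v ⟨hj, hk⟩ hv
    simp only [sectorTriangle, ← sideAngle_succ, Set.mem_ofPred_eq] at hj hk
    have aj := planeAngle_mem_of_cone hκ j.2 (lt_of_le_of_ne hj.1 (hv _).symm)
      (lt_of_le_of_ne hj.2.1 (hv _))
    have ak := planeAngle_mem_of_cone hκ k.2 (lt_of_le_of_ne hk.1 (hv _).symm)
      (lt_of_le_of_ne hk.2.1 (hv _))
    rcases lt_or_gt_of_ne hjk with h | h
    · have := sideAngle_mono κ (show (j : ℕ) + 1 ≤ k from h)
      linarith [aj.2, ak.1]
    · have := sideAngle_mono κ (show (k : ℕ) + 1 ≤ j from h)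
      linarith [ak.2, aj.1]

lemma volume_regularPolygon (hκ : 3 ≤ κ) : volume (regularPolygon κ) = 1 := by
  have hs := sin_half_step_pos hκ
  have hc := cos_half_step_pos hκ
  have hκ0 : (0 : ℝ) < κ := by positivity
  set f : ℂ →ₗ[ℝ] ℂ := LinearMap.mul ℝ ℂ (-polyCenter κ) with hf
  have hdet : LinearMap.det f = Complex.normSq (polyCenter κ) := by
    rw [← Complex.normSq_neg, ← Algebra.norm_complex_apply, Algebra.norm_apply]; rfl
  have hnorm : Complex.normSq (polyCenter κ) = (sideLength κ / (2 * Real.sin (Real.pi / κ))) ^ 2 := by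
    have h2 := Real.sin_sq_add_cos_sq (Real.pi / κ)
    rw [polyCenter_eq hκ, Complex.normSq_apply]
    simp only [Complex.smul_re, Complex.smul_im, smul_eq_mul]
    linear_combination (sideLength κ / (2 * Real.sin (Real.pi / κ))) ^ 2 * h2
  have hpos : 0 < LinearMap.det f := by
    rw [hdet]; exact Complex.normSq_pos.2 (polyCenter_ne_zero hκ)
  have h := Measure.addHaar_preimage_linearMap volume hpos.ne'
    ((fun w => polyCenter κ + w) ⁻¹' regularPolygon κ)
  rw [measure_preimage_add] at h
  have hset : f ⁻¹' ((fun w => polyCenter κ + w) ⁻¹' regularPolygon κ) =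
      ⋃ j : Fin κ, sectorTriangle κ j := by
    ext v
    have e : polyCenter κ + f v = polyCenter κ - polyCenter κ * v := by simp [hf, sub_eq_add_neg]
    simp only [Set.mem_preimage, Set.mem_iUnion, sectorTriangle, ← sideAngle_succ]
    rw [e]
    constructor
    · intro hv
      obtain ⟨j, h1, h2⟩ := exists_sector hκ v
      exact ⟨j, h1, h2, sector_bound_of_sideHeight_nonneg hκ j
        ((mem_regularPolygon_iff hκ _).1 hv j)⟩
    · rintro ⟨j, h1, h2, h3⟩
      exact mem_regularPolygon_of_sector hκ j h1 h2 h3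
  rw [hset, volume_iUnion_sectorTriangle hκ, abs_of_pos (inv_pos.2 hpos)] at h
  have hd : κ * (Real.sin (2 * Real.pi / κ) / 2) = (LinearMap.det f)⁻¹ := by
    have hr : sideLength κ ^ 2 = 4 * Real.tan (Real.pi / κ) / κ := by
      rw [sideLength, Real.sq_sqrt]
      have := tan_half_step_pos hκ
      positivity
    rw [hdet, hnorm, div_pow, hr, show 2 * Real.pi / κ = 2 * (Real.pi / κ) by ring, Real.sin_two_mul,
      Real.tan_eq_sin_div_cos]
    field_simp
    ring
  rw [hd] at h
  have h0 : ENNReal.ofReal (LinearMap.det f)⁻¹ ≠ 0 := by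
    rw [Ne, ENNReal.ofReal_eq_zero, not_le]; exact inv_pos.2 hpos
  exact (ENNReal.mul_right_inj h0 ENNReal.ofReal_ne_top).1 (by rw [mul_one]; exact h.symm)

lemma uniformLaw_eq (hκ : 3 ≤ κ) (n : ℕ) : uniformLaw κ n =
    volume.restrict (Set.univ.pi fun _ : Fin n => regularPolygon κ) := by
  have h : (cond volume (regularPolygon κ) : Measure ℂ) = volume.restrict (regularPolygon κ) := by
    rw [ProbabilityTheory.cond, volume_regularPolygon hκ, inv_one, one_smul]
  rw [uniformLaw, h, volume_pi, Measure.restrict_pi_pi]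

end Regular

/-! ### Blocks of consecutive indices -/

/-- The index at which the `j`-th block starts, for blocks of consecutive indices of sizes `s`. -/
def blockStart {κ : ℕ} (s : Fin κ → ℕ) (j : ℕ) : ℕ := ∑ i ∈ Finset.univ.filter fun i : Fin κ => (i : ℕ) < j, s i

/-- The map `b` sends each index to its block. -/
def IsBlockMap {κ n : ℕ} (s : Fin κ → ℕ) (b : Fin n → Fin κ) : Prop :=
  ∀ i, blockStart s (b i) ≤ i ∧ (i : ℕ) < blockStart s (b i + 1)

/-- The index of the `j`-th contact point of a tuple of size-vector `s`. -/
def contactPt {κ : ℕ} (n : ℕ) [NeZero n] (s : Fin κ → ℕ) (j : ℕ) : Fin n :=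
  Fin.ofNat n (blockStart s j)

section Blocks

variable {κ n : ℕ} {s : Fin κ → ℕ} {b : Fin n → Fin κ}

lemma blockStart_zero (s : Fin κ → ℕ) : blockStart s 0 = 0 := by simp [blockStart]

lemma blockStart_succ (s : Fin κ → ℕ) (j : Fin κ) :
    blockStart s (j + 1) = blockStart s j + s j := by
  rw [blockStart, blockStart]
  have : (Finset.univ.filter fun i : Fin κ => (i : ℕ) < j + 1) =
      insert j (Finset.univ.filter fun i : Fin κ => (i : ℕ) < j) := by
    ext i
    simp only [Finset.mem_filter, Finset.mem_univ, true_and, Finset.mem_insert, Fin.ext_iff]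
    omega
  rw [this, Finset.sum_insert (by simp), add_comm]

lemma blockStart_mono (s : Fin κ → ℕ) : Monotone (blockStart s) := fun i j h =>
  Finset.sum_le_sum_of_subset fun k hk => by
    simp only [Finset.mem_filter, Finset.mem_univ, true_and] at hk ⊢; omega

lemma blockStart_self (s : Fin κ → ℕ) : blockStart s κ = ∑ j, s j := by
  simp [blockStart]

lemma exists_isBlockMap (hs : ∑ j, s j = n) : ∃ b : Fin n → Fin κ, IsBlockMap s b := by
  have h : ∀ i : Fin n, ∃ j : Fin κ, blockStart s j ≤ i ∧ (i : ℕ) < blockStart s (j + 1) := by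
    intro i
    have hex : ∃ j, (i : ℕ) < blockStart s (j + 1) :=
      ⟨κ, i.2.trans_le (by rw [← hs, ← blockStart_self]; exact blockStart_mono s (Nat.le_succ κ))⟩
    classical
    have hspec := Nat.find_spec hex
    have hle : blockStart s (Nat.find hex) ≤ i := by
      rcases Nat.eq_zero_or_pos (Nat.find hex) with h | h
      · rw [h, blockStart_zero]; exact Nat.zero_le _
      · have := Nat.find_min hex (m := Nat.find hex - 1) (by omega)
        rw [Nat.sub_add_cancel h] at this
        omega
    have hlt : Nat.find hex < κ := by
      by_contra hge
      have := blockStart_mono s (not_lt.1 hge)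
      rw [blockStart_self, hs] at this
      have := i.2
      omega
    exact ⟨⟨Nat.find hex, hlt⟩, hle, hspec⟩
  choose b hb using h
  exact ⟨b, hb⟩

lemma IsBlockMap.lt_blockStart_iff (hb : IsBlockMap s b) (i : Fin n) (j : ℕ) :
    (i : ℕ) < blockStart s j ↔ (b i : ℕ) < j := by
  constructor
  · intro h
    by_contra hj
    have := blockStart_mono s (not_lt.1 hj)
    have := (hb i).1
    omega
  · intro h
    have := blockStart_mono s (show (b i : ℕ) + 1 ≤ j from h)
    have := (hb i).2
    omega

lemma IsBlockMap.eq_of_mem (hb : IsBlockMap s b) {i : Fin n} {j : Fin κ}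
    (h1 : blockStart s j ≤ i) (h2 : (i : ℕ) < blockStart s (j + 1)) : b i = j := by
  rw [hb.lt_blockStart_iff] at h2
  have : ¬ ((i : ℕ) < blockStart s j) := by omega
  rw [hb.lt_blockStart_iff] at this
  exact Fin.ext (by omega)

lemma IsBlockMap.monotone (hb : IsBlockMap s b) : Monotone b := by
  intro i k hik
  by_contra h
  have h : (b k : ℕ) < b i := not_le.1 h
  rw [← hb.lt_blockStart_iff] at h
  have := (hb i).1
  have : (i : ℕ) ≤ k := hik
  omega

lemma blockStart_le (hs : ∑ j, s j = n) {j : ℕ} (hj : j ≤ κ) : blockStart s j ≤ n := by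
  rw [← hs, ← blockStart_self]; exact blockStart_mono s hj

/-- If one block had size `n`, then all the other ones would be empty and, since `κ ≥ 3`, two of them
would be adjacent. -/
lemma admissible_lt (hκ : 3 ≤ κ) (hs : s ∈ admissibleSizes κ n) (j : Fin κ) : s j < n := by
  obtain ⟨hsum, hadm⟩ := hs
  by_contra hge
  have hge := not_lt.1 hge
  have hother : ∀ i, i ≠ j → s i = 0 := by
    intro i hi
    have := Finset.add_le_sum (fun k _ => Nat.zero_le (s k)) (Finset.mem_univ i) (Finset.mem_univ j) hi
    omega
  have h1 := hadm (finRotate κ (finRotate κ j))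
  rw [Equiv.symm_apply_apply] at h1
  have e1 := finRotate_val_cases hκ j
  have e2 := finRotate_val_cases hκ (finRotate κ j)
  have n1 : finRotate κ j ≠ j := fun h => by rw [h] at e1; omega
  have n2 : finRotate κ (finRotate κ j) ≠ j := fun h => by rw [h] at e2; omega
  rw [hother _ n1, hother _ n2] at h1
  exact h1 rfl

end Blocks

/-! ### Canonical tuples with a given size-vector -/

section Points

variable {κ n : ℕ} {s : Fin κ → ℕ} {b : Fin n → Fin κ} {z : Fin n → ℂ}

/-- The `i`-th edge of the polygon `z` lies in the closed cone spanned by the directions of the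
sides `b i` and `b i + 1`. -/
def InCones (κ : ℕ) (b : Fin n → Fin κ) (z : Fin n → ℂ) : Prop :=
  ∀ i, 0 ≤ height (sideAngle κ (b i)) (edge z i) ∧ height (sideAngle κ (b i + 1)) (edge z i) ≤ 0

/-- The signed distances of the contact points to their sides, if the size-vector is `s`. -/
noncomputable def contactHeights [NeZero n] (κ : ℕ) (s : Fin κ → ℕ) (z : Fin n → ℂ) (j : Fin κ) : ℝ :=
  sideHeight κ j (z (contactPt n s j))

lemma Generic.height_edge_ne' (hκ : 3 ≤ κ) (h : Generic κ z) (hn : 2 ≤ n) (j : Fin κ)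
    (i : Fin n) : height (sideAngle κ (j + 1)) (edge z i) ≠ 0 := by
  rw [sideAngle_succ, ← height_finRotate hκ]; exact h.height_edge_ne hn _ i

lemma planeAngle_edge_mem (hκ : 3 ≤ κ) (hn : 2 ≤ n) (hz : Generic κ z) (hc : InCones κ b z)
    (i : Fin n) : sideAngle κ (b i) < planeAngle (edge z i) ∧
      planeAngle (edge z i) < sideAngle κ (b i + 1) :=
  planeAngle_mem_of_cone hκ (b i).2 (lt_of_le_of_ne (hc i).1 (hz.height_edge_ne hn _ _).symm)
    (lt_of_le_of_ne (hc i).2 (hz.height_edge_ne' hκ hn _ _))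

lemma splits_blockStart (hκ : 3 ≤ κ) (hn : 2 ≤ n) (hz : Generic κ z) (hsum : ∑ j, s j = n)
    (hb : IsBlockMap s b) (hc : InCones κ b z) : Splits κ z (blockStart s) := by
  refine fun j => ⟨blockStart_le hsum j.2.le, fun i hi => ?_, fun i hi => ?_⟩
  · rw [hb.lt_blockStart_iff] at hi
    exact (planeAngle_edge_mem hκ hn hz hc i).2.le.trans (sideAngle_mono κ hi)
  · rw [← not_lt, hb.lt_blockStart_iff, not_lt] at hi
    exact (sideAngle_mono κ hi).trans (planeAngle_edge_mem hκ hn hz hc i).1.le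

/-- A monotone family of angles passes `α` after the number of angles less than `α`. -/
lemma lt_card_filter_iff {θ : Fin n → ℝ} (hθ : Monotone θ) (α : ℝ) (i : Fin n) :
    (i : ℕ) < (Finset.univ.filter fun k => θ k < α).card ↔ θ i < α := by
  constructor
  · intro h
    by_contra hi
    have hsub : (Finset.univ.filter fun k => θ k < α) ⊆ Finset.Iio i := by
      intro k hk
      rw [Finset.mem_Iio]
      by_contra hki
      exact hi ((hθ (not_lt.1 hki)).trans_lt (Finset.mem_filter.1 hk).2)
    have := Finset.card_le_card hsub
    rw [Fin.card_Iio] at this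
    omega
  · intro h
    have hsub : Finset.Iic i ⊆ (Finset.univ.filter fun k => θ k < α) := by
      intro k hk
      exact Finset.mem_filter.2 ⟨Finset.mem_univ _, (hθ (Finset.mem_Iic.1 hk)).trans_lt h⟩
    have := Finset.card_le_card hsub
    rw [Fin.card_Iic] at this
    omega

/-- Two successive edges of a strictly convex polygon have different directions. -/
lemma strictMono_of_convexIndependent (hn : 2 ≤ n) (hz : ConvexIndependent ℝ z)
    (hmono : Monotone fun i => planeAngle (edge z i)) (hne : ∀ i, edge z i ≠ 0) :
    StrictMono fun i => planeAngle (edge z i) := by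
  have : NeZero n := ⟨by omega⟩
  have hlt : ∀ i k : Fin n, i < k → planeAngle (edge z i) ≠ planeAngle (edge z k) := by
    intro i k hik heq
    have hik' : (i : ℕ) < k := hik
    have hk := k.2
    have hval : (finRotate n i : ℕ) = i + 1 := by
      rw [finRotate_eq_ofNat, Fin.val_ofNat, Nat.mod_eq_of_lt (by omega)]
    have h1 : planeAngle (edge z i) ≤ planeAngle (edge z (finRotate n i)) :=
      hmono (Fin.le_def.2 (by rw [hval]; exact Nat.le_succ _))
    have h2 : planeAngle (edge z (finRotate n i)) ≤ planeAngle (edge z k) :=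
      hmono (Fin.le_def.2 (by rw [hval]; exact hik'))
    have h3 : planeAngle (edge z (finRotate n i)) = planeAngle (edge z i) :=
      le_antisymm (h2.trans_eq heq.symm) h1
    have hp := norm_pos_iff.2 (hne i)
    have hq := norm_pos_iff.2 (hne (finRotate n i))
    have e1 := unitDir_planeAngle (edge z i)
    have e2 := unitDir_planeAngle (edge z (finRotate n i))
    rw [h3] at e2
    set p := ‖edge z i‖
    set q := ‖edge z (finRotate n i)‖
    -- the common vertex of two successive edges of the same direction lies between the other ends
    have hmem : z (finRotate n i) ∈
        convexHull ℝ (z '' {i, finRotate n (finRotate n i)}) := by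
      rw [Set.image_pair, convexHull_pair]
      refine ⟨q / (p + q), p / (p + q), by positivity, by positivity, by field_simp; ring, ?_⟩
      have hpq : (p : ℂ) + q ≠ 0 := by
        have : p + q ≠ 0 := by positivity
        exact_mod_cast this
      have key : (q : ℂ) * edge z i = p * edge z (finRotate n i) := by
        rw [← e1, ← e2]; ring
      rw [edge, edge] at key
      rw [Complex.real_smul, Complex.real_smul]
      push_cast
      field_simp
      linear_combination (-1 : ℂ) * key
    rcases hz _ _ hmem with h | h
    · exact finRotate_ne_self hn i h
    · exact finRotate_ne_self hn (finRotate n i) h.symm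
  refine hmono.strictMono_of_injective fun i k h => ?_
  rcases lt_trichotomy i k with h' | h' | h'
  · exact absurd h (hlt _ _ h')
  · exact h'
  · exact absurd h.symm (hlt _ _ h')

/-- A closed polygon whose edges turn strictly, by less than a full turn in total, is convex: the
direction `α` strictly between those of two successive edges exposes their common vertex. -/
lemma convexIndependent_of_strictMono [NeZero n]
    (hmono : StrictMono fun i => planeAngle (edge z i)) (h0 : ∀ i, height 0 (edge z i) ≠ 0) :
    ConvexIndependent ℝ z := by
  have hexp : ∀ i : Fin n, ∃ α, ∀ k, k ≠ i → height α (z i) < height α (z k) := by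
    intro i
    rcases Nat.eq_zero_or_pos (i : ℕ) with hi | hi
    · refine ⟨0, fun k hk => ?_⟩
      have e : Fin.ofNat n 0 = i := Fin.ext (by simp [hi])
      have := height_lt_of_monotone (m := 0) le_rfl Real.two_pi_pos.le hmono.monotone h0
        (Nat.zero_le _) (fun i hi => absurd hi (Nat.not_lt_zero _))
        (fun i _ => (planeAngle_mem _).1) (i := k) (by rw [e]; exact hk)
      rwa [e] at this
    · have hin := i.2
      let i' : Fin n := ⟨i - 1, by omega⟩
      have hlt : planeAngle (edge z i') < planeAngle (edge z i) :=
        hmono (Fin.lt_def.2 (show (i : ℕ) - 1 < i by omega))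
      -- avoid the finitely many directions to which some edge is parallel
      obtain ⟨α, ⟨hα1, hα2⟩, hα⟩ := ((Set.Ioo_infinite hlt).sdiff (Set.finite_iUnion fun k : Fin n =>
        ((Set.finite_singleton (planeAngle (edge z k) + Real.pi)).insert
          (planeAngle (edge z k))).insert (planeAngle (edge z k) - Real.pi))).nonempty
      have hα0 : 0 ≤ α := (planeAngle_mem _).1.trans hα1.le
      have hα2' : α ≤ 2 * Real.pi := hα2.le.trans (planeAngle_mem _).2.le
      have hne : ∀ k, height α (edge z k) ≠ 0 := by
        intro k hk
        rw [height_eq_norm_mul_sin] at hk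
        have hk0 : ‖edge z k‖ ≠ 0 := fun h => h0 k (by rw [norm_eq_zero.1 h, map_zero])
        obtain ⟨t, ht⟩ := Real.sin_eq_zero_iff.1 ((mul_eq_zero.1 hk).resolve_left hk0)
        obtain ⟨b0, b1⟩ := planeAngle_mem (edge z k)
        have hα2'' : α < 2 * Real.pi := hα2.trans (planeAngle_mem _).2
        have hπ := Real.pi_pos
        have t1 : t < 2 := by
          have : (t : ℝ) < 2 := by nlinarith
          exact_mod_cast this
        have t2 : -2 < t := by
          have : (-2 : ℝ) < t := by nlinarith
          exact_mod_cast this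
        apply hα
        rw [Set.mem_iUnion]
        refine ⟨k, ?_⟩
        have : t = -1 ∨ t = 0 ∨ t = 1 := by omega
        rcases this with rfl | rfl | rfl
        · right; right; push_cast at ht; simp only [Set.mem_singleton_iff]; linarith
        · right; left; push_cast at ht; linarith
        · left; push_cast at ht; linarith
      refine ⟨α, fun k hk => ?_⟩
      have := height_lt_of_monotone (m := i) hα0 hα2' hmono.monotone hne i.2.le
        (fun k hk => ((hmono.monotone (Fin.le_def.2 (show (k : ℕ) ≤ i - 1 by omega) : k ≤ i')).trans
          hα1.le))
        (fun k hk => hα2.le.trans (hmono.monotone (Fin.le_def.2 hk))) (i := k)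
        (by rw [ofNat_val_self]; exact hk)
      rwa [ofNat_val_self] at this
  rw [convexIndependent_iff_notMem_convexHull_sdiff]
  intro i t hmem
  obtain ⟨α, hα⟩ := hexp i
  have hsub : convexHull ℝ (z '' (t \ {i})) ⊆ {w | height α (z i) < height α w} := by
    refine convexHull_min ?_ (convex_halfSpace_gt (height α).isLinear _)
    rintro _ ⟨k, ⟨_, hk⟩, rfl⟩
    exact hα k hk
  exact lt_irrefl (height α (z i)) (hsub hmem)

lemma sideDist_eq_contactHeights [NeZero n] (hκ : 3 ≤ κ) (hn : 2 ≤ n) (hz : Generic κ z)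
    (hsum : ∑ j, s j = n) (hb : IsBlockMap s b) (hc : InCones κ b z)
    (hmono : StrictMono fun i => planeAngle (edge z i))
    (hpos : ∀ j, 0 ≤ contactHeights κ s z j) : sideDist κ z = contactHeights κ s z := by
  have hspl := splits_blockStart hκ hn hz hsum hb hc
  funext j
  refine sideDist_eq_of_splits hκ hn hz hmono.monotone hspl j fun i => ?_
  by_cases hi : i = Fin.ofNat n (blockStart s j)
  · rw [hi]; exact hpos j
  · exact (hpos j).trans (sideHeight_lt_of_splits hκ hn hz hmono.monotone hspl j hi).le

/-- A polygon in general position with sorted edges that lie in the cones of `b` is canonically ordered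
and has size-vector `s`; it lies in the regular polygon once its contact points do. -/
lemma mem_fullSidedSet_of_inCones [NeZero n] (hκ : 3 ≤ κ) (hn : 2 ≤ n) (hz : Generic κ z)
    (hs : s ∈ admissibleSizes κ n) (hb : IsBlockMap s b) (hc : InCones κ b z)
    (hmono : StrictMono fun i => planeAngle (edge z i))
    (hpos : ∀ j, 0 ≤ contactHeights κ s z j) : z ∈ fullSidedSet κ n ∧ sizeVector κ z = s := by
  have hspl := splits_blockStart hκ hn hz hs.1 hb hc
  have hposi : ∀ (j : Fin κ) i, 0 ≤ sideHeight κ j (z i) := by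
    intro j i
    by_cases hi : i = Fin.ofNat n (blockStart s j)
    · rw [hi]; exact hpos j
    · exact (hpos j).trans (sideHeight_lt_of_splits hκ hn hz hmono.monotone hspl j hi).le
  have hsize : sizeVector κ z = s := by
    funext j
    rw [sizeVector_eq_of_splits hκ hn hz hmono.monotone hspl (blockStart_zero s)
      ((blockStart_self s).trans hs.1) (blockStart_mono s) j hposi, blockStart_succ,
      Nat.add_sub_cancel_left, Nat.mod_eq_of_lt (admissible_lt hκ hs j)]
  have h0 : ∀ i, height 0 (edge z i) ≠ 0 := fun i => by
    have := hz.height_edge_ne hn ⟨0, by omega⟩ i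
    rwa [sideAngle_zero] at this
  refine ⟨⟨⟨⟨convexIndependent_of_strictMono hmono h0, ?_, hmono.monotone⟩,
    fun i => (mem_regularPolygon_iff hκ _).2 fun j => hposi j i⟩, by rw [hsize]; exact hs⟩, hsize⟩
  intro i₀ i hi₀
  have e : Fin.ofNat n 0 = i₀ := Fin.ext (by simp [hi₀])
  by_cases hi : i = i₀
  · rw [hi]; exact Or.inr ⟨rfl, le_rfl⟩
  · left
    have := height_lt_of_monotone (m := 0) le_rfl Real.two_pi_pos.le hmono.monotone h0
      (Nat.zero_le _) (fun i hi => absurd hi (Nat.not_lt_zero _))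
      (fun i _ => (planeAngle_mem _).1) (i := i) (by rw [e]; exact hi)
    rwa [e, height_zero_apply, height_zero_apply] at this

/-- Conversely, in a canonically ordered tuple of size-vector `s` the `j`-th block of edges consists of
the edges with an angle between those of the `j`-th and the next side. -/
lemma inCones_of_mem_fullSidedSet [NeZero n] (hκ : 3 ≤ κ) (hn : 2 ≤ n) (hz : Generic κ z)
    (hs : s ∈ admissibleSizes κ n) (hb : IsBlockMap s b) (hfull : z ∈ fullSidedSet κ n)
    (hsize : sizeVector κ z = s) : InCones κ b z ∧
      (StrictMono fun i => planeAngle (edge z i)) ∧ ∀ j, 0 ≤ contactHeights κ s z j := by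
  obtain ⟨⟨⟨hci, -, hmono⟩, hK⟩, -⟩ := hfull
  have hmono : Monotone fun i => planeAngle (edge z i) := hmono
  have hposi : ∀ (j : Fin κ) i, 0 ≤ sideHeight κ j (z i) := fun j i =>
    (mem_regularPolygon_iff hκ _).1 (hK i) j
  have hne : ∀ i, edge z i ≠ 0 := fun i h =>
    hz.height_edge_ne hn ⟨0, by omega⟩ i (by rw [h, map_zero])
  set m : ℕ → ℕ := fun j => (Finset.univ.filter fun k => planeAngle (edge z k) < sideAngle κ j).card
    with hm
  have hmlt : ∀ (j : ℕ) (i : Fin n), (i : ℕ) < m j ↔ planeAngle (edge z i) < sideAngle κ j :=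
    fun j i => lt_card_filter_iff hmono _ i
  have hspl : Splits κ z m := fun j => ⟨(Finset.card_le_univ _).trans_eq (Fintype.card_fin n),
    fun i hi => ((hmlt _ _).1 hi).le, fun i hi => not_lt.1 fun h => by
      have := (hmlt _ _).2 h; omega⟩
  have hm0 : m 0 = 0 := by
    simp only [hm, sideAngle_zero, Finset.card_eq_zero, Finset.filter_eq_empty_iff, not_lt]
    exact fun i _ => (planeAngle_mem _).1
  have hmκ : m κ = n := by
    simp only [hm, sideAngle_self hκ]
    rw [Finset.filter_true_of_mem fun i _ => (planeAngle_mem _).2, Finset.card_univ,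
      Fintype.card_fin]
  have hmm : Monotone m := fun i j hij => Finset.card_le_card
    (Finset.monotone_filter_right _ fun k _ hk => lt_of_lt_of_le hk (sideAngle_mono κ hij))
  have hsj : ∀ j : Fin κ, s j = (m (j + 1) - m j) % n := fun j => by
    rw [← hsize]; exact sizeVector_eq_of_splits hκ hn hz hmono hspl hm0 hmκ hmm j hposi
  have hsum : ∑ j : Fin κ, (m (j + 1) - m j) = n := by
    rw [Fin.sum_univ_eq_sum_range (fun j => m (j + 1) - m j), Finset.sum_range_tsub hmm, hmκ, hm0,
      Nat.sub_zero]
  -- sizes are defined modulo `n`, but an admissible size-vector has sum `n`, like the increments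
  have hst : ∀ j : Fin κ, s j = m (j + 1) - m j := by
    have hle : ∀ j ∈ Finset.univ, s j ≤ m ((j : ℕ) + 1) - m j := fun j _ => by
      rw [hsj j]; exact Nat.mod_le _ _
    have := (Finset.sum_eq_sum_iff_of_le hle).1 (hs.1.trans hsum.symm)
    exact fun j => this j (Finset.mem_univ j)
  have hstart : ∀ j ≤ κ, blockStart s j = m j := by
    intro j
    induction j with
    | zero => intro _; rw [blockStart_zero, hm0]
    | succ j ih =>
      intro hj
      have := blockStart_succ s ⟨j, hj⟩
      have h2 := hmm (Nat.le_succ j)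
      have h3 := hst ⟨j, hj⟩
      simp only at this h3
      rw [this, ih (Nat.le_of_succ_le hj), h3]
      have h2 : m j ≤ m (j + 1) := h2
      omega
  refine ⟨fun i => ?_, strictMono_of_convexIndependent hn hci hmono hne, fun j => hposi _ _⟩
  have h1 := (hb i).1
  have h2 := (hb i).2
  rw [hstart _ (b i).2.le, ← not_lt, hmlt, not_lt] at h1
  rw [hstart _ (b i).2, hmlt] at h2
  have hstep := step_lt_pi hκ
  constructor
  · rw [height_eq_norm_mul_sin]
    refine mul_nonneg (norm_nonneg _) (Real.sin_nonneg_of_nonneg_of_le_pi (by linarith) ?_)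
    rw [sideAngle_succ] at h2
    linarith
  · rw [height_eq_norm_mul_sin]
    refine mul_nonpos_of_nonneg_of_nonpos (norm_nonneg _)
      (Real.sin_nonpos_of_nonpos_of_neg_pi_le (by linarith) ?_)
    rw [sideAngle_succ] at h2 ⊢
    linarith

end Points

/-! ### Contact points and blocks -/

section Contact

variable {κ n : ℕ} {s : Fin κ → ℕ} {b : Fin n → Fin κ} {z : Fin n → ℂ}

lemma contactPt_finRotate [NeZero n] (hκ : 3 ≤ κ) (hsum : ∑ j, s j = n) (j : Fin κ) :
    contactPt n s (finRotate κ j : Fin κ) = contactPt n s (j + 1) := by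
  rcases finRotate_val_cases hκ j with ⟨_, h⟩ | ⟨h1, h⟩
  · rw [h]
  · rw [h, h1, contactPt, contactPt, blockStart_zero, blockStart_self, hsum]
    apply Fin.ext; simp

lemma contactPt_val [NeZero n] (hsum : ∑ j, s j = n) {j : Fin κ} (hj : s j ≠ 0) :
    (contactPt n s j : ℕ) = blockStart s j := by
  have h1 := blockStart_succ s j
  have h2 := blockStart_le hsum (show (j : ℕ) + 1 ≤ κ from j.2)
  rw [contactPt, Fin.val_ofNat, Nat.mod_eq_of_lt (by omega)]

lemma IsBlockMap.apply_contactPt [NeZero n] (hb : IsBlockMap s b) (hsum : ∑ j, s j = n) {j : Fin κ}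
    (hj : s j ≠ 0) : b (contactPt n s j) = j := by
  have h := contactPt_val hsum hj
  have h1 := blockStart_succ s j
  exact hb.eq_of_mem h.ge (by omega)

lemma contactPt_eq_of_eq_zero [NeZero n] (hκ : 3 ≤ κ) (hsum : ∑ j, s j = n) {j : Fin κ} (hj : s j = 0) :
    contactPt n s (finRotate κ j : Fin κ) = contactPt n s j := by
  rw [contactPt_finRotate hκ hsum, contactPt, contactPt, blockStart_succ, hj, add_zero]

lemma IsBlockMap.finRotate_cases [NeZero n] (hκ : 3 ≤ κ) (hb : IsBlockMap s b) (hsum : ∑ j, s j = n)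
    (i : Fin n) :
    ((i : ℕ) + 1 < blockStart s (b i + 1) ∧ (finRotate n i : ℕ) = i + 1 ∧
      b (finRotate n i) = b i) ∨ finRotate n i = contactPt n s (finRotate κ (b i) : Fin κ) := by
  have h1 := (hb i).1
  have h2 := (hb i).2
  have h3 := blockStart_le hsum (show (b i : ℕ) + 1 ≤ κ from (b i).2)
  rcases Nat.lt_or_ge ((i : ℕ) + 1) (blockStart s (b i + 1)) with h | h
  · left
    have hv : (finRotate n i : ℕ) = i + 1 := by
      rw [finRotate_eq_ofNat, Fin.val_ofNat, Nat.mod_eq_of_lt (by omega)]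
    exact ⟨h, hv, hb.eq_of_mem (by omega) (by omega)⟩
  · right
    rw [contactPt_finRotate hκ hsum, contactPt, finRotate_eq_ofNat]
    congr 1; omega

/-- The last edge of a nonempty block ends at the next contact point. -/
lemma IsBlockMap.exists_last [NeZero n] (hκ : 3 ≤ κ) (hb : IsBlockMap s b) (hsum : ∑ j, s j = n) {j : Fin κ}
    (hj : s j ≠ 0) : ∃ i, b i = j ∧ finRotate n i = contactPt n s (finRotate κ j : Fin κ) := by
  have h1 := blockStart_succ s j
  have h3 := blockStart_le hsum (show (j : ℕ) + 1 ≤ κ from j.2)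
  refine ⟨⟨blockStart s (j + 1) - 1, by omega⟩,
    hb.eq_of_mem (by simp only; omega) (by simp only; omega), ?_⟩
  rw [contactPt_finRotate hκ hsum, contactPt, finRotate_eq_ofNat]
  congr 1
  simp only; omega

lemma sum_edge_lt [NeZero n] (z : Fin n → ℂ) {m : ℕ} (hm : m ≤ n) :
    ∑ i ∈ Finset.univ.filter (fun i : Fin n => (i : ℕ) < m), edge z i =
      z (Fin.ofNat n m) - z (Fin.ofNat n 0) := by
  induction m with
  | zero => simp
  | succ m ih =>
    have : (Finset.univ.filter fun i : Fin n => (i : ℕ) < m + 1) =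
        insert ⟨m, hm⟩ (Finset.univ.filter fun i : Fin n => (i : ℕ) < m) := by
      ext i
      simp only [Finset.mem_filter, Finset.mem_univ, true_and, Finset.mem_insert, Fin.ext_iff]
      omega
    rw [this, Finset.sum_insert (by simp), ih (by omega), edge, finRotate_eq_ofNat]
    have e : (⟨m, hm⟩ : Fin n) = Fin.ofNat n m := Fin.ext (by simp [Nat.mod_eq_of_lt hm])
    rw [e, Fin.val_ofNat, Nat.mod_eq_of_lt hm]
    ring

/-- The edges of a block join two consecutive contact points. -/
lemma IsBlockMap.sum_edge [NeZero n] (hκ : 3 ≤ κ) (hb : IsBlockMap s b) (hsum : ∑ j, s j = n)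
    (z : Fin n → ℂ) (j : Fin κ) : ∑ i ∈ Finset.univ.filter (fun i => b i = j), edge z i =
      z (contactPt n s (finRotate κ j : Fin κ)) - z (contactPt n s j) := by
  have h1 := sum_edge_lt z (blockStart_le hsum (show (j : ℕ) + 1 ≤ κ from j.2))
  have h0 := sum_edge_lt z (blockStart_le hsum j.2.le)
  have hdisj : Disjoint (Finset.univ.filter fun i => b i = j)
      (Finset.univ.filter fun i : Fin n => (i : ℕ) < blockStart s j) := by
    rw [Finset.disjoint_filter]
    rintro i _ rfl h
    rw [hb.lt_blockStart_iff] at h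
    exact lt_irrefl _ h
  have hunion : (Finset.univ.filter fun i : Fin n => (i : ℕ) < blockStart s (j + 1)) =
      (Finset.univ.filter fun i => b i = j) ∪
        (Finset.univ.filter fun i : Fin n => (i : ℕ) < blockStart s j) := by
    ext i
    simp only [Finset.mem_union, Finset.mem_filter, Finset.mem_univ, true_and,
      hb.lt_blockStart_iff, Fin.ext_iff]
    omega
  rw [hunion, Finset.sum_union hdisj, h0] at h1
  rw [contactPt_finRotate hκ hsum, contactPt, contactPt]
  linear_combination h1

lemma IsBlockMap.card_fiber (hb : IsBlockMap s b) (hsum : ∑ j, s j = n) (j : Fin κ) :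
    (Finset.univ.filter fun i => b i = j).card = s j := by
  have hle := blockStart_le hsum (show (j : ℕ) + 1 ≤ κ from j.2)
  have h : (Finset.univ.filter fun i => b i = j).map Fin.valEmbedding =
      Finset.Ico (blockStart s j) (blockStart s (j + 1)) := by
    ext k
    simp only [Finset.mem_map, Finset.mem_filter, Finset.mem_univ, true_and, Fin.valEmbedding_apply,
      Finset.mem_Ico]
    constructor
    · rintro ⟨i, rfl, rfl⟩; exact hb i
    · rintro ⟨h1, h2⟩; exact ⟨⟨k, by omega⟩, hb.eq_of_mem h1 h2, rfl⟩
  rw [← Finset.card_map, h, Nat.card_Ico, blockStart_succ, Nat.add_sub_cancel_left]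

/-! ### Components of the edges along the sides -/

/-- The coordinate which gives the distance of the `j`-th contact point to the `j`-th side. It takes
the place of a component of an edge at this point: the one of index `(i, false)` if the `j`-th block
starts at `i` or, if the `j`-th block is empty, the one of index `(i, true)`. -/
def contactCoord (n : ℕ) [NeZero n] (s : Fin κ → ℕ) (j : Fin κ) : Fin n × Bool :=
  (contactPt n s j, decide (s j = 0))

/-- Each edge has two components, along the sides that bound its cone. The component of index
`(i, true)` is that of the edge leaving `z i` along the first of its two sides, the component of
index `(i, false)` is that of the edge ending at `z i` along the second one (both multiplied by the
sine of the angle between the two sides). -/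
noncomputable def edgeComp (κ : ℕ) (b : Fin n → Fin κ) (z : Fin n → ℂ) : Fin n × Bool → ℝ
  | (i, false) => height (sideAngle κ (b ((finRotate n).symm i))) (edge z ((finRotate n).symm i))
  | (i, true) => - height (sideAngle κ (finRotate κ (b i) : Fin κ)) (edge z i)

/-- The side along which a component is measured. -/
def compSide (b : Fin n → Fin κ) : Fin n × Bool → Fin κ
  | (i, false) => finRotate κ (b ((finRotate n).symm i))
  | (i, true) => b i

lemma inCones_iff_edgeComp (hκ : 3 ≤ κ) : InCones κ b z ↔ ∀ e, 0 ≤ edgeComp κ b z e := by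
  have e : ∀ j : Fin κ, height (sideAngle κ (finRotate κ j : Fin κ)) = height (sideAngle κ (j + 1)) :=
    fun j => by rw [height_finRotate hκ, sideAngle_succ]
  constructor
  · rintro h ⟨i, _ | _⟩
    · exact (h _).1
    · rw [edgeComp, e]; linarith [(h i).2]
  · intro h i
    constructor
    · have := h (finRotate n i, false)
      rwa [edgeComp, Equiv.symm_apply_apply] at this
    · have := h (i, true)
      rw [edgeComp, e] at this
      linarith

/-- The components along a side add up to the length `r - cl_j(ℓ)` of this side in the
circumscribed equiangular polygon. -/
lemma sum_edgeComp [NeZero n] (hκ : 3 ≤ κ) (hb : IsBlockMap s b) (hsum : ∑ j, s j = n) (z : Fin n → ℂ)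
    (j : Fin κ) : ∑ e ∈ Finset.univ.filter (fun e => compSide b e = j), edgeComp κ b z e =
      Real.sin (interiorAngle κ) * (sideLength κ - sideComb κ (contactHeights κ s z) j) := by
  have hs := sin_step_pos hκ
  rw [Finset.sum_filter, Fintype.sum_prod_type]
  simp only [Fintype.sum_bool]
  rw [Finset.sum_add_distrib]
  have h2 : ∑ i : Fin n, (if compSide b (i, true) = j then edgeComp κ b z (i, true) else 0) =
      - height (sideAngle κ (finRotate κ j : Fin κ)) (z (contactPt n s (finRotate κ j : Fin κ)) -
        z (contactPt n s j)) := by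
    rw [← hb.sum_edge hκ hsum z j, map_sum, ← Finset.sum_neg_distrib, Finset.sum_filter]
    refine Finset.sum_congr rfl fun i _ => ?_
    by_cases h : b i = j
    · rw [if_pos h, if_pos (show compSide b (i, true) = j from h), edgeComp, h]
    · rw [if_neg h, if_neg (show ¬ compSide b (i, true) = j from h)]
  have h1 : ∑ i : Fin n, (if compSide b (i, false) = j then edgeComp κ b z (i, false) else 0) =
      height (sideAngle κ ((finRotate κ).symm j : Fin κ)) (z (contactPt n s j) -
        z (contactPt n s ((finRotate κ).symm j : Fin κ))) := by
    have := hb.sum_edge hκ hsum z ((finRotate κ).symm j)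
    rw [Equiv.apply_symm_apply] at this
    rw [← this, map_sum, Finset.sum_filter, ← (finRotate n).symm.sum_comp (fun i => if b i = _ then
      height (sideAngle κ ((finRotate κ).symm j : Fin κ)) (edge z i) else 0)]
    refine Finset.sum_congr rfl fun i _ => ?_
    by_cases h : b ((finRotate n).symm i) = (finRotate κ).symm j
    · rw [if_pos h, if_pos (show compSide b (i, false) = j from (Equiv.eq_symm_apply _).1 h),
        edgeComp, h]
    · rw [if_neg h, if_neg (show ¬ compSide b (i, false) = j from
        fun h' => h ((Equiv.eq_symm_apply _).2 h'))]
  rw [h1, h2]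
  have g := sideHeight_prev_add_next hκ j (z (contactPt n s j))
  have g1 := sideHeight_sub κ ((finRotate κ).symm j : Fin κ) (z (contactPt n s j))
    (z (contactPt n s ((finRotate κ).symm j : Fin κ)))
  have g2 := sideHeight_sub κ (finRotate κ j : Fin κ) (z (contactPt n s (finRotate κ j : Fin κ)))
    (z (contactPt n s j))
  rw [← g1, ← g2, mul_sub, sideComb, cos_interiorAngle hκ, sin_interiorAngle hκ,
    mul_div_cancel₀ _ hs.ne']
  simp only [contactHeights]
  linear_combination g

lemma card_compSide (hb : IsBlockMap s b) (hsum : ∑ j, s j = n) (j : Fin κ) :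
    (Finset.univ.filter fun e => compSide b e = j).card = s ((finRotate κ).symm j) + s j := by
  rw [← hb.card_fiber hsum j, ← hb.card_fiber hsum ((finRotate κ).symm j), Finset.card_filter,
    Fintype.sum_prod_type]
  simp only [Fintype.sum_bool]
  rw [Finset.sum_add_distrib, add_comm, Finset.card_filter, Finset.card_filter]
  congr 1
  · rw [← (finRotate n).symm.sum_comp (fun i => if b i = (finRotate κ).symm j then 1 else 0)]
    exact Finset.sum_congr rfl fun i _ => if_congr (Equiv.eq_symm_apply _).symm rfl rfl

lemma compSide_contactCoord_surjective [NeZero n] (hκ : 3 ≤ κ) (hb : IsBlockMap s b)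
    (hs : s ∈ admissibleSizes κ n) :
    Function.Surjective fun j => compSide b (contactCoord n s j) := by
  obtain ⟨hsum, hadm⟩ := hs
  have hadm' : ∀ j, s j = 0 → s (finRotate κ j) ≠ 0 := fun j h h' => hadm (finRotate κ j) (by
    rw [Equiv.symm_apply_apply, h, h'])
  intro j
  obtain ⟨i, rfl⟩ := (finRotate κ).surjective j
  by_cases hi : s i = 0
  · refine ⟨i, ?_⟩
    have : contactCoord n s i = (contactPt n s i, true) := by rw [contactCoord, decide_eq_true hi]
    simp only [this, compSide]
    rw [← contactPt_eq_of_eq_zero hκ hsum hi, hb.apply_contactPt hsum (hadm' _ hi)]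
  · obtain ⟨k, hk, hk'⟩ := hb.exists_last hκ hsum hi
    by_cases hj : s (finRotate κ i) = 0
    · refine ⟨finRotate κ (finRotate κ i), ?_⟩
      have : contactCoord n s (finRotate κ (finRotate κ i)) =
          (contactPt n s (finRotate κ (finRotate κ i) : Fin κ), false) := by
        rw [contactCoord, decide_eq_false (hadm' _ hj)]
      simp only [this, compSide]
      rw [contactPt_eq_of_eq_zero hκ hsum hj, ← hk', Equiv.symm_apply_apply, hk]
    · refine ⟨finRotate κ i, ?_⟩
      have : contactCoord n s (finRotate κ i) =
          (contactPt n s (finRotate κ i : Fin κ), false) := by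
        rw [contactCoord, decide_eq_false hj]
      simp only [this, compSide]
      rw [← hk', Equiv.symm_apply_apply, hk]

end Contact

/-! ### The linear change of coordinates -/

/-- A matrix `N` whose nonzero entries strictly decrease a rank is strictly triangular in the order of
the ranks, so `1 - N` is unipotent. -/
lemma det_one_sub_of_rank {E : Type*} [Fintype E] [DecidableEq E] (N : Matrix E E ℝ) (r : E → ℕ)
    (h : ∀ e e', N e e' ≠ 0 → r e' < r e) : (1 - N).det = 1 := by
  have hblock : (1 - N).BlockTriangular (OrderDual.toDual ∘ r) := by
    intro e e' hlt
    have hlt : r e < r e' := hlt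
    have hne : e ≠ e' := fun h => by rw [h] at hlt; exact lt_irrefl _ hlt
    have h0 : N e e' = 0 := by
      by_contra h0
      exact absurd (h e e' h0) (by omega)
    rw [Matrix.sub_apply, Matrix.one_apply_ne hne, h0, sub_zero]
  rw [hblock.det]
  refine Finset.prod_eq_one fun a _ => ?_
  have : (1 - N).toSquareBlock (OrderDual.toDual ∘ r) a = 1 := by
    ext ⟨e, he⟩ ⟨e', he'⟩
    have h0 : N e e' = 0 := by
      by_contra h0
      have hr : r e = r e' := he.trans he'.symm
      exact absurd (h e e' h0) (by omega)
    simp only [Matrix.toSquareBlock_def, Matrix.of_apply, Matrix.sub_apply, h0, sub_zero,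
      Matrix.one_apply, Subtype.mk.injEq]
  rw [this, Matrix.det_one]

/-- The real and imaginary parts of `n` points, as `2n` real coordinates. -/
def reImCoord {n : ℕ} (w : Fin n → ℂ) : Fin n × Bool → ℝ
  | (i, false) => (w i).re
  | (i, true) => (w i).im

lemma measurePreserving_reImCoord (n : ℕ) : MeasurePreserving (reImCoord (n := n)) := by
  have hmeas : Measurable (reImCoord (n := n)) := by
    refine measurable_pi_iff.2 ?_
    rintro ⟨i, _ | _⟩
    · exact Complex.measurable_re.comp (measurable_pi_apply i)
    · exact Complex.measurable_im.comp (measurable_pi_apply i)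
  refine ⟨hmeas, ?_⟩
  rw [volume_pi (α := fun _ : Fin n × Bool => ℝ)]
  refine (Measure.pi_eq fun t ht => ?_).symm
  rw [Measure.map_apply hmeas (MeasurableSet.univ_pi ht)]
  have hset : reImCoord ⁻¹' (Set.univ.pi t) =
      Set.univ.pi fun i : Fin n => (t (i, false)) ×ℂ (t (i, true)) := by
    ext w
    simp only [Set.mem_preimage, Set.mem_univ_pi, Complex.mem_reProdIm]
    constructor
    · exact fun h i => ⟨h (i, false), h (i, true)⟩
    · rintro h ⟨i, _ | _⟩
      · exact (h i).1
      · exact (h i).2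
  rw [hset, volume_pi, Measure.pi_pi, Fintype.prod_prod_type]
  refine Finset.prod_congr rfl fun i _ => ?_
  have hprod : (t (i, false)) ×ℂ (t (i, true)) =
      Complex.measurableEquivRealProd ⁻¹' (t (i, false) ×ˢ t (i, true)) := rfl
  rw [hprod, Complex.volume_preserving_equiv_real_prod.measure_preimage
    ((ht _).prod (ht _)).nullMeasurableSet, Measure.volume_eq_prod, Measure.prod_prod,
    Fintype.prod_bool, mul_comm]

section Coordinates

variable {κ n : ℕ} {s : Fin κ → ℕ} {b : Fin n → Fin κ} {z : Fin n → ℂ}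

/-- Each point is described by its heights over two neighbouring sides: that of its block and the
next one or, if the point is a contact point for this previous side too, the previous one. -/
def coordSide (s : Fin κ → ℕ) (b : Fin n → Fin κ) : Fin n × Bool → Fin κ
  | (i, false) => b i
  | (i, true) => if (i : ℕ) = blockStart s (b i) ∧ s ((finRotate κ).symm (b i)) = 0 then
      (finRotate κ).symm (b i) else finRotate κ (b i)

/-- The point to which `z i` is compared to get a component of an edge. -/
def neighbour : Fin n × Bool → Fin n
  | (i, false) => (finRotate n).symm i
  | (i, true) => finRotate n i

lemma sin_sideAngle_sub (hκ : 3 ≤ κ) (j : Fin κ) :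
    Real.sin (sideAngle κ (finRotate κ j : Fin κ) - sideAngle κ j) =
      Real.sin (2 * Real.pi / κ) := by
  rcases finRotate_val_cases hκ j with ⟨_, h⟩ | ⟨h1, h⟩
  · rw [h, sideAngle_succ, add_sub_cancel_left]
  · have h2 := sideAngle_succ κ j
    rw [h1, sideAngle_self hκ] at h2
    rw [h, ← Real.sin_add_two_pi, sideAngle_zero]
    congr 1; linarith

lemma abs_sin_coordSide (hκ : 3 ≤ κ) (s : Fin κ → ℕ) (b : Fin n → Fin κ) (i : Fin n) :
    |Real.sin (sideAngle κ (coordSide s b (i, true)) - sideAngle κ (coordSide s b (i, false)))| =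
      Real.sin (interiorAngle κ) := by
  have hs := sin_step_pos hκ
  simp only [coordSide]
  rw [sin_interiorAngle hκ]
  split_ifs
  · have h := sin_sideAngle_sub hκ ((finRotate κ).symm (b i))
    rw [Equiv.apply_symm_apply] at h
    rw [← neg_sub, Real.sin_neg, h, abs_neg, abs_of_pos hs]
  · rw [sin_sideAngle_sub hκ, abs_of_pos hs]

lemma admissible_next_ne_zero (hs : s ∈ admissibleSizes κ n) {j : Fin κ} (hj : s j = 0) :
    s (finRotate κ j) ≠ 0 := fun h => hs.2 (finRotate κ j) (by
  rw [Equiv.symm_apply_apply, hj, h])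

lemma IsBlockMap.size_ne_zero (hb : IsBlockMap s b) (i : Fin n) : s (b i) ≠ 0 := by
  have h := hb i
  have := blockStart_succ s (b i)
  omega

lemma IsBlockMap.contactPt_eq [NeZero n] (hb : IsBlockMap s b) (hsum : ∑ j, s j = n) {i : Fin n}
    (hi : (i : ℕ) = blockStart s (b i)) : contactPt n s (b i) = i :=
  Fin.ext ((contactPt_val hsum (hb.size_ne_zero i)).trans hi.symm)

lemma coordSide_contactCoord [NeZero n] (hκ : 3 ≤ κ) (hb : IsBlockMap s b)
    (hs : s ∈ admissibleSizes κ n) (j : Fin κ) : coordSide s b (contactCoord n s j) = j := by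
  by_cases hj : s j = 0
  · have h1 := admissible_next_ne_zero hs hj
    have h2 := contactPt_val hs.1 h1
    have h3 := hb.apply_contactPt hs.1 h1
    rw [contactPt_eq_of_eq_zero hκ hs.1 hj] at h2 h3
    rw [contactCoord, decide_eq_true hj, coordSide, h3, Equiv.symm_apply_apply, if_pos ⟨h2, hj⟩]
  · rw [contactCoord, decide_eq_false hj, coordSide, hb.apply_contactPt hs.1 hj]

lemma not_first_of_notMem_range [NeZero n] (hb : IsBlockMap s b) (hsum : ∑ j, s j = n) {i : Fin n}
    (hi : (i, false) ∉ Set.range (contactCoord n s)) : (i : ℕ) ≠ blockStart s (b i) := fun h =>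
  hi ⟨b i, by rw [contactCoord, decide_eq_false (hb.size_ne_zero i), hb.contactPt_eq hsum h]⟩

lemma not_skip_of_notMem_range [NeZero n] (hκ : 3 ≤ κ) (hb : IsBlockMap s b)
    (hsum : ∑ j, s j = n) {i : Fin n} (hi : (i, true) ∉ Set.range (contactCoord n s)) :
    ¬ ((i : ℕ) = blockStart s (b i) ∧ s ((finRotate κ).symm (b i)) = 0) := fun h =>
  hi ⟨(finRotate κ).symm (b i), by
    have := contactPt_eq_of_eq_zero hκ hsum h.2
    rw [Equiv.apply_symm_apply, hb.contactPt_eq hsum h.1] at this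
    rw [contactCoord, decide_eq_true h.2, ← this]⟩

lemma IsBlockMap.apply_pred [NeZero n] (hb : IsBlockMap s b) {i : Fin n}
    (hi : (i : ℕ) ≠ blockStart s (b i)) :
    (((finRotate n).symm i : Fin n) : ℕ) + 1 = i ∧ b ((finRotate n).symm i) = b i := by
  have h1 := (hb i).1
  have h2 := (hb i).2
  have hin := i.2
  have e : (finRotate n).symm i = ⟨i - 1, by omega⟩ := by
    rw [Equiv.symm_apply_eq, finRotate_eq_ofNat]
    apply Fin.ext
    rw [Fin.val_ofNat]
    simp only
    rw [Nat.sub_add_cancel (by omega), Nat.mod_eq_of_lt hin]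
  rw [e]
  exact ⟨by simp only; omega, hb.eq_of_mem (by simp only; omega) (by simp only; omega)⟩

lemma height_sub_neighbour [NeZero n] (hκ : 3 ≤ κ) (hb : IsBlockMap s b) (hsum : ∑ j, s j = n)
    (z : Fin n → ℂ) {e : Fin n × Bool} (he : e ∉ Set.range (contactCoord n s)) :
    height (sideAngle κ (coordSide s b e)) (z e.1 - z (neighbour e)) = edgeComp κ b z e := by
  obtain ⟨i, _ | _⟩ := e
  · have h := hb.apply_pred (not_first_of_notMem_range hb hsum he)
    simp only [coordSide, neighbour, edgeComp, edge, h.2, Equiv.apply_symm_apply]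
  · simp only [coordSide, neighbour, edgeComp, edge]
    rw [if_neg (not_skip_of_notMem_range hκ hb hsum he), ← map_neg, neg_sub]

open Classical in
/-- A rank for which the height of a point and that of its neighbour over the same side are
triangularly related. -/
noncomputable def coordRank [NeZero n] (s : Fin κ → ℕ) (e : Fin n × Bool) : ℕ :=
  if e ∈ Set.range (contactCoord n s) then 0 else if e.2 then n - e.1 else e.1 + 1

/-- The height of the neighbour is itself one of the coordinates, of smaller rank. -/
lemma exists_predecessor [NeZero n] (hκ : 3 ≤ κ) (hb : IsBlockMap s b)
    (hs : s ∈ admissibleSizes κ n) {e : Fin n × Bool}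
    (he : e ∉ Set.range (contactCoord n s)) : ∃ e', coordRank s e' < coordRank s e ∧
      coordSide s b e' = coordSide s b e ∧ e'.1 = neighbour e := by
  have hpos : coordRank s e = if e.2 then n - e.1 else e.1 + 1 := by rw [coordRank, if_neg he]
  have hle : ∀ e : Fin n × Bool, coordRank s e ≤ if e.2 then n - e.1 else e.1 + 1 := by
    intro e
    rw [coordRank]
    by_cases h : e ∈ Set.range (contactCoord n s)
    · rw [if_pos h]; exact Nat.zero_le _
    · rw [if_neg h]
  obtain ⟨i, _ | _⟩ := e
  · have h := hb.apply_pred (not_first_of_notMem_range hb hs.1 he)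
    refine ⟨((finRotate n).symm i, false), (hle _).trans_lt ?_, ?_, rfl⟩
    · rw [hpos]; simp only [Bool.false_eq_true, if_false]; omega
    · simp only [coordSide, h.2]
  · have hskip := not_skip_of_notMem_range hκ hb hs.1 he
    have hi := i.2
    rcases hb.finRotate_cases hκ hs.1 i with ⟨h1, h2, h3⟩ | h
    · refine ⟨(finRotate n i, true), (hle _).trans_lt ?_, ?_, rfl⟩
      · rw [hpos]; simp only [if_true, h2]; omega
      · simp only [coordSide]
        have := (hb i).1
        rw [if_neg hskip, h3, if_neg (by rw [h2]; omega)]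
    · refine ⟨contactCoord n s (finRotate κ (b i)), ?_, ?_, h.symm⟩
      · rw [hpos, coordRank, if_pos ⟨_, rfl⟩]; simp only [if_true]; omega
      · rw [coordSide_contactCoord hκ hb hs]
        simp only [coordSide]
        rw [if_neg hskip]

/-- The heights of the contact points and all but `κ` of the components of the edges are linear
coordinates on the space of `n` points, and the change of coordinates multiplies volumes by
`sin(θ_κ)^n`. Each point contributes a factor `sin θ_κ`, when it is described by its heights over
two neighbouring sides; what remains is a unipotent map. -/
lemma exists_coordinates [NeZero n] (hκ : 3 ≤ κ) (hb : IsBlockMap s b)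
    (hs : s ∈ admissibleSizes κ n) : ∃ R : (Fin n → ℂ) → (Fin n × Bool → ℝ),
      (∀ B, MeasurableSet B → volume (R ⁻¹' B) =
        ENNReal.ofReal ((Real.sin (interiorAngle κ) ^ n)⁻¹) * volume B) ∧
      (∀ z j, R z (contactCoord n s j) = height (sideAngle κ j) (z (contactPt n s j))) ∧
      ∀ z, ∀ e ∉ Set.range (contactCoord n s), R z e = edgeComp κ b z e := by
  classical
  have hsin : 0 < Real.sin (interiorAngle κ) := by rw [sin_interiorAngle hκ]; exact sin_step_pos hκ
  have hpred : ∀ e : Fin n × Bool, ∃ e', e ∉ Set.range (contactCoord n s) →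
      coordRank s e' < coordRank s e ∧ coordSide s b e' = coordSide s b e ∧ e'.1 = neighbour e := by
    intro e
    by_cases he : e ∈ Set.range (contactCoord n s)
    · exact ⟨e, fun h => absurd he h⟩
    · obtain ⟨e', h⟩ := exists_predecessor hκ hb hs he
      exact ⟨e', fun _ => h⟩
  choose pred hpred using hpred
  -- `N` replaces the height of a point by that of its neighbour over the same side, so that `1 - N`
  -- turns heights into components of edges, and leaves the heights of the contact points unchanged
  set N : Matrix (Fin n × Bool) (Fin n × Bool) ℝ := Matrix.of fun e e' =>
    if e ∉ Set.range (contactCoord n s) ∧ e' = pred e then 1 else 0 with hN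
  have hNdet : (1 - N).det = 1 := by
    refine det_one_sub_of_rank N (coordRank s) fun e e' h => ?_
    have hc : e ∉ Set.range (contactCoord n s) ∧ e' = pred e := by
      by_contra hc
      exact h (by rw [hN, Matrix.of_apply, if_neg hc])
    rw [hc.2]
    exact (hpred e hc.1).1
  -- `D` describes each point by its heights over two neighbouring sides
  set D : (Fin n → ℂ) →ₗ[ℝ] (Fin n → ℂ) := LinearMap.pi fun i =>
    (heightPair (sideAngle κ (coordSide s b (i, false)))
      (sideAngle κ (coordSide s b (i, true)))).comp (LinearMap.proj i) with hD
  have hDdet : |LinearMap.det D| = Real.sin (interiorAngle κ) ^ n := by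
    rw [hD, LinearMap.det_pi, Finset.abs_prod]
    simp only [det_heightPair, abs_sin_coordSide hκ, Finset.prod_const, Finset.card_univ,
      Fintype.card_fin]
  have hDapp : ∀ z e, reImCoord (D z) e = height (sideAngle κ (coordSide s b e)) (z e.1) := by
    rintro z ⟨i, _ | _⟩
    · simp only [reImCoord, hD, LinearMap.pi_apply, LinearMap.comp_apply, LinearMap.proj_apply,
        heightPair_re]
    · simp only [reImCoord, hD, LinearMap.pi_apply, LinearMap.comp_apply, LinearMap.proj_apply,
        heightPair_im]
  have hR : ∀ z e, Matrix.toLin' (1 - N) (reImCoord (D z)) e =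
      height (sideAngle κ (coordSide s b e)) (z e.1) - if e ∈ Set.range (contactCoord n s) then 0
        else height (sideAngle κ (coordSide s b e)) (z (neighbour e)) := by
    intro z e
    rw [Matrix.toLin'_apply, Matrix.sub_mulVec, Matrix.one_mulVec, Pi.sub_apply, hDapp]
    congr 1
    rw [Matrix.mulVec, dotProduct]
    by_cases he : e ∈ Set.range (contactCoord n s)
    · rw [if_pos he]
      refine Finset.sum_eq_zero fun e' _ => ?_
      rw [hN, Matrix.of_apply, if_neg (fun h => h.1 he), zero_mul]
    · rw [if_neg he, Finset.sum_eq_single (pred e)]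
      · rw [hN, Matrix.of_apply, if_pos ⟨he, rfl⟩, one_mul, hDapp, (hpred e he).2.1,
          (hpred e he).2.2]
      · intro e' _ h
        rw [hN, Matrix.of_apply, if_neg (fun h' => h h'.2), zero_mul]
      · exact fun h => absurd (Finset.mem_univ _) h
  refine ⟨fun z => Matrix.toLin' (1 - N) (reImCoord (D z)), fun B hB => ?_, fun z j => ?_,
    fun z e he => ?_⟩
  · have e1 : (fun z => Matrix.toLin' (1 - N) (reImCoord (D z))) ⁻¹' B =
      D ⁻¹' (reImCoord ⁻¹' (Matrix.toLin' (1 - N) ⁻¹' B)) := rfl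
    have hm : MeasurableSet (Matrix.toLin' (1 - N) ⁻¹' B) :=
      (Matrix.toLin' (1 - N)).continuous_of_finiteDimensional.measurable hB
    rw [e1, Measure.addHaar_preimage_linearMap _
      (by rw [← abs_pos, hDdet]; positivity), (measurePreserving_reImCoord n).measure_preimage
      hm.nullMeasurableSet, Measure.addHaar_preimage_linearMap _
      (by rw [LinearMap.det_toLin', hNdet]; exact one_ne_zero), LinearMap.det_toLin', hNdet,
      abs_inv, hDdet]
    simp
  · refine (hR z _).trans ?_
    rw [if_pos ⟨j, rfl⟩, sub_zero, coordSide_contactCoord hκ hb hs]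
    rfl
  · refine (hR z e).trans ?_
    rw [if_neg he, ← map_sub, height_sub_neighbour hκ hb hs.1 z he]

end Coordinates

/-! ### The volume of the tuples with edges in given cones -/

@[fun_prop]
lemma continuous_sideComb (κ : ℕ) (j : Fin κ) : Continuous fun l : Fin κ → ℝ => sideComb κ l j := by
  unfold sideComb; fun_prop

section Volume

variable {κ n : ℕ} {s : Fin κ → ℕ} {b : Fin n → Fin κ}

/-- The coordinates split into the heights of the contact points and the other ones. -/
noncomputable def contactCoordEquiv [NeZero n] {s : Fin κ → ℕ}
    (hp : Function.Injective (contactCoord n s)) :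
    Fin κ ⊕ ((Set.range (contactCoord n s))ᶜ : Set (Fin n × Bool)) ≃ Fin n × Bool :=
  letI : DecidablePred (· ∈ Set.range (contactCoord n s)) := Classical.decPred _
  (Equiv.sumCongr (Equiv.ofInjective _ hp) (Equiv.refl _)).trans
    (Equiv.Set.sumCompl (Set.range (contactCoord n s)))

lemma contactCoordEquiv_inl [NeZero n] (hp : Function.Injective (contactCoord n s)) (j : Fin κ) :
    contactCoordEquiv hp (Sum.inl j) = contactCoord n s j := by
  simp [contactCoordEquiv]

lemma contactCoordEquiv_inr [NeZero n] (hp : Function.Injective (contactCoord n s))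
    (e : ((Set.range (contactCoord n s))ᶜ : Set (Fin n × Bool))) :
    contactCoordEquiv hp (Sum.inr e) = e := by
  simp [contactCoordEquiv]

lemma contactCoord_injective [NeZero n] (hκ : 3 ≤ κ) (hb : IsBlockMap s b)
    (hs : s ∈ admissibleSizes κ n) : Function.Injective (contactCoord n s) :=
  Function.LeftInverse.injective (coordSide_contactCoord hκ hb hs)

open Classical in
/-- Each side carries exactly one of the omitted components. -/
lemma sum_compSide_eq [NeZero n] (hκ : 3 ≤ κ) (hb : IsBlockMap s b) (hs : s ∈ admissibleSizes κ n)
    {M : Type*} [AddCommMonoid M] (f : Fin n × Bool → M) (q : Fin κ) :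
    ∑ e ∈ Finset.univ.filter (fun e => compSide b e = compSide b (contactCoord n s q)), f e =
      f (contactCoord n s q) + ∑ e ∈ Finset.univ.filter
        (fun e : ((Set.range (contactCoord n s))ᶜ : Set (Fin n × Bool)) =>
          compSide b e = compSide b (contactCoord n s q)), f e := by
  have hinj : Function.Injective fun j => compSide b (contactCoord n s j) :=
    Finite.injective_iff_surjective.2 (compSide_contactCoord_surjective hκ hb hs)
  rw [Finset.sum_filter, Finset.sum_filter,
    ← (contactCoordEquiv (contactCoord_injective hκ hb hs)).sum_comp, Fintype.sum_sum_type]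
  simp only [contactCoordEquiv_inl, contactCoordEquiv_inr]
  congr 1
  rw [Finset.sum_eq_single q]
  · rw [if_pos rfl]
  · intro k _ hk
    rw [if_neg fun h => hk (hinj h)]
  · exact fun h => absurd (Finset.mem_univ _) h

/-- The signs of the omitted components are read off the other ones and the side lengths of the
circumscribed polygon. -/
lemma inCones_iff_mem_simplexProd [NeZero n] (hκ : 3 ≤ κ) (hb : IsBlockMap s b)
    (hs : s ∈ admissibleSizes κ n) (z : Fin n → ℂ) : InCones κ b z ↔
      (fun e : ((Set.range (contactCoord n s))ᶜ : Set (Fin n × Bool)) => edgeComp κ b z e) ∈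
        simplexProd (fun e : ((Set.range (contactCoord n s))ᶜ : Set (Fin n × Bool)) => compSide b e)
          (fun j => Real.sin (interiorAngle κ) *
            (sideLength κ - sideComb κ (contactHeights κ s z) j)) := by
  classical
  rw [inCones_iff_edgeComp hκ, simplexProd, Set.mem_ofPred_eq,
    (compSide_contactCoord_surjective hκ hb hs).forall]
  have hq : ∀ q, (∑ e ∈ Finset.univ.filter
        (fun e : ((Set.range (contactCoord n s))ᶜ : Set (Fin n × Bool)) =>
          compSide b e = compSide b (contactCoord n s q)), edgeComp κ b z e ≤
      Real.sin (interiorAngle κ) * (sideLength κ -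
        sideComb κ (contactHeights κ s z) (compSide b (contactCoord n s q)))) ↔
      0 ≤ edgeComp κ b z (contactCoord n s q) := by
    intro q
    rw [← sum_edgeComp hκ hb hs.1, sum_compSide_eq hκ hb hs]
    constructor <;> intro h <;> linarith
  constructor
  · intro h
    refine ⟨fun e => h e, fun q => ?_⟩
    convert (hq q).2 (h _)
  · rintro ⟨h1, h2⟩ e
    by_cases he : e ∈ Set.range (contactCoord n s)
    · obtain ⟨q, rfl⟩ := he
      refine (hq q).1 ?_
      convert h2 q
    · exact h1 ⟨e, he⟩

open Classical in
lemma card_compSide_compl [NeZero n] (hκ : 3 ≤ κ) (hb : IsBlockMap s b)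
    (hs : s ∈ admissibleSizes κ n) (j : Fin κ) :
    (Finset.univ.filter fun e : ((Set.range (contactCoord n s))ᶜ : Set (Fin n × Bool)) =>
      compSide b e = j).card = s ((finRotate κ).symm j) + s j - 1 := by
  obtain ⟨q, rfl⟩ := compSide_contactCoord_surjective hκ hb hs j
  have h := sum_compSide_eq hκ hb hs (fun _ => 1) q
  rw [← Finset.card_eq_sum_ones, ← Finset.card_eq_sum_ones, card_compSide hb hs.1] at h
  simp only at h ⊢
  omega

/-- The volume of the tuples with edges in the cones given by `b`, as an integral over the
distances of the contact points: over given distances the components of the edges along the sides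
form a product of simplices. -/
lemma volume_inCones [NeZero n] (hκ : 3 ≤ κ) (hb : IsBlockMap s b) (hs : s ∈ admissibleSizes κ n)
    {A : Set (Fin κ → ℝ)} (hA : MeasurableSet A) :
    volume {z : Fin n → ℂ | InCones κ b z ∧ contactHeights κ s z ∈ A} =
      ENNReal.ofReal ((Real.sin (interiorAngle κ) ^ n)⁻¹) * ∫⁻ l in A,
        ∏ j, simplexVol (s ((finRotate κ).symm j) + s j - 1)
          (Real.sin (interiorAngle κ) * (sideLength κ - sideComb κ l j)) := by
  classical
  obtain ⟨R, hvol, hRp, hRc⟩ := exists_coordinates hκ hb hs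
  -- the signed distances to the sides are heights up to these constants
  set off : Fin κ → ℝ := fun j => apothem κ - height (sideAngle κ j) (polyCenter κ) with hoff
  have hp := contactCoord_injective hκ hb hs
  -- the admissible values of the pair (distances, remaining components)
  set B' : Set ((Fin κ → ℝ) × (((Set.range (contactCoord n s))ᶜ : Set (Fin n × Bool)) → ℝ)) :=
    {x | x.1 + off ∈ A ∧ x.2 ∈ simplexProd
      (fun e : ((Set.range (contactCoord n s))ᶜ : Set (Fin n × Bool)) => compSide b e)
      (fun j => Real.sin (interiorAngle κ) * (sideLength κ - sideComb κ (x.1 + off) j))} with hB'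
  have hB'm : MeasurableSet B' := by
    have h1 : MeasurableSet {x : (Fin κ → ℝ) ×
        (((Set.range (contactCoord n s))ᶜ : Set (Fin n × Bool)) → ℝ) | x.1 + off ∈ A} :=
      (measurable_fst.add_const off) hA
    have h2 : IsClosed {x : (Fin κ → ℝ) ×
        (((Set.range (contactCoord n s))ᶜ : Set (Fin n × Bool)) → ℝ) | x.2 ∈ simplexProd
      (fun e : ((Set.range (contactCoord n s))ᶜ : Set (Fin n × Bool)) => compSide b e)
      (fun j => Real.sin (interiorAngle κ) * (sideLength κ - sideComb κ (x.1 + off) j))} := by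
      simp only [simplexProd, Set.mem_ofPred_eq]
      rw [Set.ofPred_and, Set.ofPred_forall, Set.ofPred_forall]
      refine (isClosed_iInter fun e => isClosed_le (by fun_prop) (by fun_prop)).inter
        (isClosed_iInter fun j => isClosed_le (by fun_prop) ?_)
      have := (continuous_sideComb κ j).comp (continuous_fst.add_const off :
        Continuous fun x : (Fin κ → ℝ) ×
          (((Set.range (contactCoord n s))ᶜ : Set (Fin n × Bool)) → ℝ) => x.1 + off)
      simp only [Function.comp_def] at this
      fun_prop
    exact h1.inter h2.measurableSet
  let S : (Fin n × Bool → ℝ) → (Fin κ → ℝ) ×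
      (((Set.range (contactCoord n s))ᶜ : Set (Fin n × Bool)) → ℝ) :=
    fun ρ => (fun j => ρ (contactCoord n s j), fun e => ρ e)
  have hS : MeasurePreserving S := by
    have h := (volume_measurePreserving_sumPiEquivProdPi (fun _ : Fin κ ⊕
      ((Set.range (contactCoord n s))ᶜ : Set (Fin n × Bool)) => ℝ)).comp
      (volume_measurePreserving_piCongrLeft (fun _ : Fin n × Bool => ℝ) (contactCoordEquiv hp)).symm
    have hSeq : S = ⇑(MeasurableEquiv.sumPiEquivProdPi fun _ : Fin κ ⊕
        ((Set.range (contactCoord n s))ᶜ : Set (Fin n × Bool)) => ℝ) ∘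
        ⇑(MeasurableEquiv.piCongrLeft (fun _ : Fin n × Bool => ℝ) (contactCoordEquiv hp)).symm :=
      funext fun ρ => Prod.ext
        (funext fun j => congrArg ρ (contactCoordEquiv_inl hp j).symm)
      (funext fun e => congrArg ρ (contactCoordEquiv_inr hp e).symm)
    rw [hSeq]
    exact h
  have hset : {z : Fin n → ℂ | InCones κ b z ∧ contactHeights κ s z ∈ A} = R ⁻¹' (S ⁻¹' B') := by
    ext z
    have h1 : (S (R z)).1 + off = contactHeights κ s z := by
      funext j
      simp only [S, Pi.add_apply, hRp, hoff, contactHeights, sideHeight, map_sub]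
      ring
    have h2 : (S (R z)).2 = fun e : ((Set.range (contactCoord n s))ᶜ : Set (Fin n × Bool)) =>
        edgeComp κ b z e := funext fun e => hRc z e e.2
    rw [Set.mem_preimage, Set.mem_preimage, hB', Set.mem_ofPred_eq, Set.mem_ofPred_eq, h1, h2,
      inCones_iff_mem_simplexProd hκ hb hs, and_comm]
  rw [hset, hvol _ (hS.measurable hB'm), hS.measure_preimage hB'm.nullMeasurableSet,
    Measure.volume_eq_prod, Measure.prod_apply hB'm]
  congr 1
  rw [← lintegral_indicator hA]
  refine Eq.trans ?_ (lintegral_add_right_eq_self _ off)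
  refine lintegral_congr fun l => ?_
  by_cases hl : l + off ∈ A
  · rw [Set.indicator_of_mem hl]
    have : Prod.mk l ⁻¹' B' = simplexProd
        (fun e : ((Set.range (contactCoord n s))ᶜ : Set (Fin n × Bool)) => compSide b e)
        (fun j => Real.sin (interiorAngle κ) * (sideLength κ - sideComb κ (l + off) j)) := by
      ext w
      simp [hB', hl]
    rw [this, volume_simplexProd]
    refine Finset.prod_congr rfl fun j _ => ?_
    rw [← card_compSide_compl hκ hb hs j]
  · rw [Set.indicator_of_notMem hl]
    have : Prod.mk l ⁻¹' B' = ∅ := by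
      ext w
      simp [hB', hl]
    rw [this, measure_empty]

end Volume

/-! ### Almost every tuple is in general position -/

section AE

variable {κ n : ℕ}

lemma ae_generic (κ n : ℕ) : ∀ᵐ z : Fin n → ℂ, Generic κ z := by
  simp only [Generic, ae_all_iff]
  intro j i k hik
  have h := Measure.addHaar_submodule volume (LinearMap.ker ((height (sideAngle κ j)).comp
    ((LinearMap.proj i : (Fin n → ℂ) →ₗ[ℝ] ℂ) - LinearMap.proj k))) (by
    intro h
    have : Pi.single i (Complex.I * unitDir (sideAngle κ j)) ∈
        LinearMap.ker ((height (sideAngle κ j)).comp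
          ((LinearMap.proj i : (Fin n → ℂ) →ₗ[ℝ] ℂ) - LinearMap.proj k)) := by
      rw [h]; trivial
    rw [LinearMap.mem_ker, LinearMap.comp_apply, LinearMap.sub_apply, LinearMap.proj_apply,
      LinearMap.proj_apply, Pi.single_eq_same, Pi.single_eq_of_ne hik.symm, sub_zero,
      height_mul_unitDir, sub_self, height_zero_apply] at this
    simp at this)
  rw [← compl_mem_ae_iff] at h
  filter_upwards [h] with z hz
  simpa using hz

lemma finRotate_finRotate_ne (hn : 3 ≤ n) (k : Fin n) : finRotate n (finRotate n k) ≠ k := by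
  have h1 := finRotate_val_cases hn k
  have h2 := finRotate_val_cases hn (finRotate n k)
  intro h
  rw [h] at h2
  omega

/-- The cross product of two vectors of the plane. -/
def cross (u v : ℂ) : ℝ := u.im * v.re - u.re * v.im

lemma cross_eq_zero_of_planeAngle_eq {u v : ℂ} (h : planeAngle u = planeAngle v) :
    cross u v = 0 := by
  have h1 := unitDir_planeAngle u
  have h2 := unitDir_planeAngle v
  rw [cross, ← h1, ← h2, h]
  simp
  ring

/-- If one of the ends of the `i`-th edge, not in the `k`-th edge, moves horizontally, then the
`i`-th edge is parallel to the `k`-th one at most once. -/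
lemma ae_cross_edge_ne_zero (hn : 3 ≤ n) {i k : Fin n} (hik : i ≠ k) :
    ∀ᵐ z : Fin n → ℂ, (edge z k).im = 0 ∨ cross (edge z i) (edge z k) ≠ 0 := by
  have hrot : finRotate n i ≠ finRotate n k := fun h => hik ((finRotate n).injective h)
  have hne := finRotate_ne_self (by omega : 2 ≤ n) i
  obtain ⟨a, c, hak, hark, hc, hac⟩ : ∃ (a : Fin n) (c : ℝ), a ≠ k ∧ a ≠ finRotate n k ∧ c ≠ 0 ∧
      ∀ t : ℝ, edge (Pi.single a (t : ℂ)) i = ((c * t : ℝ) : ℂ) := by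
    by_cases h : i = finRotate n k
    · refine ⟨finRotate n i, 1, ?_, hrot, one_ne_zero, fun t => ?_⟩
      · rw [h]; exact finRotate_finRotate_ne hn k
      · rw [edge, Pi.single_eq_same, Pi.single_eq_of_ne hne.symm]; simp
    · refine ⟨i, -1, hik, h, by norm_num, fun t => ?_⟩
      rw [edge, Pi.single_eq_same, Pi.single_eq_of_ne hne]; simp
  have hcont : ∀ m : Fin n, Continuous fun z : Fin n → ℂ => edge z m := fun m => by
    unfold edge; fun_prop
  have hs : MeasurableSet {z : Fin n → ℂ | (edge z k).im = 0 ∨ cross (edge z i) (edge z k) ≠ 0} := by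
    have h1 := hcont i
    have h2 := hcont k
    refine MeasurableSet.union ?_ ?_
    · exact (isClosed_eq (by fun_prop) (by fun_prop)).measurableSet
    · unfold cross
      exact (isOpen_ne_fun (by fun_prop) (by fun_prop)).measurableSet
  refine ae_mem_of_ae_add_linearMap_mem ((LinearMap.single ℝ (fun _ : Fin n => ℂ) a).comp
    (Complex.ofRealAm.toLinearMap)) volume volume hs fun y => ?_
  have hk : ∀ t : ℝ, edge (y + Pi.single a (t : ℂ)) k = edge y k := fun t => by
    rw [edge, edge, Pi.add_apply, Pi.add_apply, Pi.single_eq_of_ne hak.symm,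
      Pi.single_eq_of_ne hark.symm, add_zero, add_zero]
  have hi : ∀ t : ℝ, edge (y + Pi.single a (t : ℂ)) i = edge y i + ((c * t : ℝ) : ℂ) := fun t => by
    rw [← hac]; simp only [edge, Pi.add_apply]; ring
  by_cases h0 : (edge y k).im = 0
  · exact Filter.Eventually.of_forall fun t => Or.inl ((congrArg Complex.im (hk t)).trans h0)
  · have hnull : volume {cross (edge y i) (edge y k) / (c * (edge y k).im)} = 0 :=
      measure_singleton _
    rw [← compl_mem_ae_iff] at hnull
    filter_upwards [hnull] with t ht
    right
    change cross (edge (y + Pi.single a (t : ℂ)) i) (edge (y + Pi.single a (t : ℂ)) k) ≠ 0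
    rw [hk, hi]
    intro h
    apply ht
    rw [Set.mem_singleton_iff, eq_div_iff (mul_ne_zero hc h0)]
    simp only [cross, Complex.add_im, Complex.add_re, Complex.ofReal_im, Complex.ofReal_re] at h ⊢
    linarith

/-- Almost surely no two edges have the same direction, so there is only one way to sort them. -/
lemma ae_planeAngle_edge_injective (hκ : 3 ≤ κ) (hn : 3 ≤ n) : ∀ᵐ z : Fin n → ℂ,
    Function.Injective fun i => planeAngle (edge z i) := by
  have h : ∀ᵐ z : Fin n → ℂ, ∀ i k : Fin n, i ≠ k →
      ((edge z k).im = 0 ∨ cross (edge z i) (edge z k) ≠ 0) := by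
    simp only [ae_all_iff]
    exact fun i k hik => ae_cross_edge_ne_zero hn hik
  filter_upwards [h, ae_generic κ n] with z hz hg i k heq
  by_contra hik
  rcases hz i k hik with h | h
  · have := hg.height_edge_ne (by omega) ⟨0, by omega⟩ k
    rw [sideAngle_zero, height_zero_apply] at this
    exact this h
  · exact h (cross_eq_zero_of_planeAngle_eq heq)

end AE

/-! ### Sorting the edges -/

section Sorting

variable {κ n : ℕ} {s : Fin κ → ℕ} {b : Fin n → Fin κ}

/-- The polygon with the same first vertex and with its edges rearranged by `σ`. -/
noncomputable def permEdges [NeZero n] (σ : Equiv.Perm (Fin n)) : (Fin n → ℂ) →ₗ[ℝ] (Fin n → ℂ) where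
  toFun z i := z (Fin.ofNat n 0) +
    ∑ k ∈ Finset.univ.filter (fun k : Fin n => (k : ℕ) < i), edge z (σ k)
  map_add' z w := by
    funext i
    have : ∀ k, edge (z + w) k = edge z k + edge w k := fun k => by
      simp only [edge, Pi.add_apply]; ring
    simp only [this, Finset.sum_add_distrib, Pi.add_apply]
    ring
  map_smul' c z := by
    funext i
    have : ∀ k, edge (c • z) k = c • edge z k := fun k => by
      simp only [edge, Pi.smul_apply, smul_sub]
    simp only [this, ← Finset.smul_sum, Pi.smul_apply, smul_add, RingHom.id_apply]

lemma permEdges_apply [NeZero n] (σ : Equiv.Perm (Fin n)) (z : Fin n → ℂ) (i : Fin n) :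
    permEdges σ z i = z (Fin.ofNat n 0) +
      ∑ k ∈ Finset.univ.filter (fun k : Fin n => (k : ℕ) < i), edge z (σ k) := rfl

lemma sum_edge_eq_zero (z : Fin n → ℂ) : ∑ i, edge z i = 0 := by
  simp only [edge, Finset.sum_sub_distrib]
  rw [Equiv.sum_comp (finRotate n) z, sub_self]

lemma edge_permEdges [NeZero n] (σ : Equiv.Perm (Fin n)) (z : Fin n → ℂ) (i : Fin n) :
    edge (permEdges σ z) i = edge z (σ i) := by
  have hi := i.2
  rw [edge, permEdges_apply, permEdges_apply, finRotate_eq_ofNat, Fin.val_ofNat]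
  rcases Nat.lt_or_ge ((i : ℕ) + 1) n with h | h
  · have : (Finset.univ.filter fun k : Fin n => (k : ℕ) < (i + 1) % n) =
        insert i (Finset.univ.filter fun k : Fin n => (k : ℕ) < i) := by
      rw [Nat.mod_eq_of_lt h]
      ext k
      simp only [Finset.mem_filter, Finset.mem_univ, true_and, Finset.mem_insert, Fin.ext_iff]
      omega
    rw [this, Finset.sum_insert (by simp)]
    ring
  · have hin : (i : ℕ) + 1 = n := by omega
    have h0 : (Finset.univ.filter fun k : Fin n => (k : ℕ) < (i + 1) % n) = ∅ := by
      rw [hin, Nat.mod_self]; simp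
    have h1 : (Finset.univ : Finset (Fin n)) =
        insert i (Finset.univ.filter fun k : Fin n => (k : ℕ) < i) := by
      ext k
      have := k.2
      simp only [Finset.mem_filter, Finset.mem_univ, true_and, true_iff, Finset.mem_insert, Fin.ext_iff]
      omega
    have h2 : ∑ k, edge z (σ k) = 0 := by rw [Equiv.sum_comp σ (edge z), sum_edge_eq_zero]
    rw [h1, Finset.sum_insert (by simp)] at h2
    rw [h0, Finset.sum_empty]
    linear_combination (-1 : ℂ) * h2

lemma permEdges_one [NeZero n] : permEdges (1 : Equiv.Perm (Fin n)) = 1 := by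
  refine LinearMap.ext fun z => funext fun i => ?_
  rw [permEdges_apply]
  simp only [Equiv.Perm.one_apply]
  rw [sum_edge_lt z i.2.le, ofNat_val_self]
  simp

lemma permEdges_mul [NeZero n] (σ τ : Equiv.Perm (Fin n)) :
    permEdges σ * permEdges τ = permEdges (τ * σ) := by
  refine LinearMap.ext fun z => funext fun i => ?_
  rw [Module.End.mul_apply, permEdges_apply, permEdges_apply]
  simp only [edge_permEdges]
  rw [permEdges_apply]
  simp

lemma permEdges_pow [NeZero n] (σ : Equiv.Perm (Fin n)) (m : ℕ) :
    permEdges σ ^ m = permEdges (σ ^ m) := by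
  induction m with
  | zero => rw [pow_zero, pow_zero, permEdges_one]
  | succ m ih => rw [pow_succ, ih, permEdges_mul, pow_succ']

/-- Rearranging the edges preserves volumes, since it is a linear map of finite order. -/
lemma abs_det_permEdges [NeZero n] (σ : Equiv.Perm (Fin n)) :
    |LinearMap.det (permEdges σ)| = 1 := by
  have h : |LinearMap.det (permEdges σ)| ^ orderOf σ = 1 := by
    rw [← abs_pow, ← map_pow, permEdges_pow, pow_orderOf_eq_one, permEdges_one, map_one, abs_one]
  exact (pow_eq_one_iff_of_nonneg (abs_nonneg _) (orderOf_pos σ).ne').1 h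

lemma volume_preimage_permEdges [NeZero n] (σ : Equiv.Perm (Fin n)) (S : Set (Fin n → ℂ)) :
    volume (permEdges σ ⁻¹' S) = volume S := by
  rw [Measure.addHaar_preimage_linearMap _ (by rw [← abs_pos, abs_det_permEdges]; exact one_pos),
    abs_inv, abs_det_permEdges]
  simp

lemma inCones_permEdges_iff [NeZero n] {σ : Equiv.Perm (Fin n)} (hσ : b ∘ σ = b) (z : Fin n → ℂ) :
    InCones κ b (permEdges σ z) ↔ InCones κ b z := by
  have hσ' : ∀ i, b (σ i) = b i := congrFun hσ
  simp only [InCones, edge_permEdges]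
  rw [← σ.forall_congr_right (q := fun i => 0 ≤ height (sideAngle κ (b i)) (edge z i) ∧
    height (sideAngle κ (b i + 1)) (edge z i) ≤ 0)]
  simp only [hσ']

lemma permEdges_contactPt [NeZero n] (hsum : ∑ j, s j = n) (hb : IsBlockMap s b)
    {σ : Equiv.Perm (Fin n)} (hσ : b ∘ σ = b) (z : Fin n → ℂ) (j : Fin κ) :
    permEdges σ z (contactPt n s j) = z (contactPt n s j) := by
  have hσ' : ∀ i, b (σ i) = b i := congrFun hσ
  rcases (blockStart_le hsum j.2.le).lt_or_eq with h | h
  · have h1 := sum_edge_lt z h.le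
    rw [permEdges_apply]
    have hv : (contactPt n s j : ℕ) = blockStart s j := by
      rw [contactPt, Fin.val_ofNat, Nat.mod_eq_of_lt h]
    have h2 : ∑ k ∈ Finset.univ.filter (fun k : Fin n => (k : ℕ) < blockStart s j), edge z (σ k) =
        ∑ k ∈ Finset.univ.filter (fun k : Fin n => (k : ℕ) < blockStart s j), edge z k := by
      rw [Finset.sum_filter, Finset.sum_filter]
      simp only [hb.lt_blockStart_iff]
      rw [← Equiv.sum_comp σ (fun k => if (b k : ℕ) < j then edge z k else 0)]
      simp only [hσ']
    rw [hv, h2, h1, contactPt]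
    ring
  · have h0 : contactPt n s j = Fin.ofNat n 0 := by
      rw [contactPt, h]; apply Fin.ext; simp
    rw [h0, permEdges_apply]
    simp

lemma contactHeights_permEdges [NeZero n] (hsum : ∑ j, s j = n) (hb : IsBlockMap s b)
    {σ : Equiv.Perm (Fin n)} (hσ : b ∘ σ = b) (z : Fin n → ℂ) :
    contactHeights κ s (permEdges σ z) = contactHeights κ s z := by
  funext j
  rw [contactHeights, contactHeights, permEdges_contactPt hsum hb hσ]

lemma planeAngle_eq_ite (w : ℂ) :
    planeAngle w = if Complex.arg w < 0 then Complex.arg w + 2 * Real.pi else Complex.arg w := by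
  have h1 := Complex.neg_pi_lt_arg w
  have h2 := Complex.arg_le_pi w
  have hπ := Real.pi_pos
  split_ifs with h
  · rw [planeAngle, ← toIcoMod_add_right, toIcoMod_eq_self]
    constructor <;> linarith
  · rw [planeAngle, toIcoMod_eq_self]
    constructor <;> linarith

lemma measurable_planeAngle : Measurable planeAngle := by
  have : planeAngle = fun w => if Complex.arg w < 0 then Complex.arg w + 2 * Real.pi
      else Complex.arg w := funext planeAngle_eq_ite
  rw [this]
  exact Measurable.ite (measurableSet_lt Complex.measurable_arg measurable_const)
    (Complex.measurable_arg.add_const _) Complex.measurable_arg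

lemma measurable_edge (i : Fin n) : Measurable fun z : Fin n → ℂ => edge z i := by
  unfold edge; fun_prop

lemma measurable_contactHeights [NeZero n] (κ : ℕ) (s : Fin κ → ℕ) :
    Measurable fun z : Fin n → ℂ => contactHeights κ s z := by
  unfold contactHeights
  exact measurable_pi_iff.2 fun j => (continuous_sideHeight κ j).measurable.comp (measurable_pi_apply _)

lemma measurableSet_inCones (κ : ℕ) (b : Fin n → Fin κ) :
    MeasurableSet {z : Fin n → ℂ | InCones κ b z} := by
  simp only [InCones, Set.ofPred_forall, Set.ofPred_and]
  refine MeasurableSet.iInter fun i => MeasurableSet.inter ?_ ?_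
  · exact measurableSet_le measurable_const ((continuous_height _).measurable.comp (measurable_edge i))
  · exact measurableSet_le ((continuous_height _).measurable.comp (measurable_edge i)) measurable_const

lemma measurableSet_strictMono_planeAngle (n : ℕ) :
    MeasurableSet {z : Fin n → ℂ | StrictMono fun i => planeAngle (edge z i)} := by
  simp only [StrictMono, Set.ofPred_forall]
  exact MeasurableSet.iInter fun i => MeasurableSet.iInter fun k => MeasurableSet.iInter fun _ =>
    measurableSet_lt (measurable_planeAngle.comp (measurable_edge i))
      (measurable_planeAngle.comp (measurable_edge k))

/-- If the edges lie in their cones and have distinct angles, sorting them permutes each block. -/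
lemma comp_sort_eq (hκ : 3 ≤ κ) (hn : 2 ≤ n) (hb : IsBlockMap s b) {z : Fin n → ℂ}
    (hz : Generic κ z) (hc : InCones κ b z) :
    b ∘ Tuple.sort (fun i => planeAngle (edge z i)) = b := by
  have hmono := Tuple.monotone_sort fun i => planeAngle (edge z i)
  set σ := Tuple.sort fun i => planeAngle (edge z i)
  refine Tuple.unique_monotone (τ := 1) (fun i k hik => ?_) (by simpa using hb.monotone)
  by_contra hlt
  have hlt : (b (σ k) : ℕ) < b (σ i) := not_le.1 hlt
  have h1 := (planeAngle_edge_mem hκ hn hz hc (σ i)).1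
  have h2 := (planeAngle_edge_mem hκ hn hz hc (σ k)).2
  have h3 := sideAngle_mono κ (show (b (σ k) : ℕ) + 1 ≤ b (σ i) from hlt)
  have h4 : planeAngle (edge z (σ i)) ≤ planeAngle (edge z (σ k)) := hmono hik
  linarith

lemma card_stabilizer (hb : IsBlockMap s b) (hsum : ∑ j, s j = n) :
    Nat.card {σ : Equiv.Perm (Fin n) // b ∘ σ = b} = ∏ j, (s j)! := by
  refine (DomMulAct.stabilizer_ncard b).trans (Finset.prod_congr rfl fun j _ => ?_)
  rw [← hb.card_fiber hsum j, ← Set.ncard_coe_finset, Finset.coe_filter]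
  simp

/-- Among the rearrangements of the edges inside the blocks, exactly one is sorted. -/
lemma volume_inCones_eq_mul [NeZero n] (hκ : 3 ≤ κ) (hn : 3 ≤ n) (hb : IsBlockMap s b)
    (hsum : ∑ j, s j = n) {A : Set (Fin κ → ℝ)} (hA : MeasurableSet A) :
    volume {z : Fin n → ℂ | InCones κ b z ∧ contactHeights κ s z ∈ A} =
      (∏ j, ((s j)! : ENNReal)) * volume {z : Fin n → ℂ | (InCones κ b z ∧ contactHeights κ s z ∈ A) ∧
        StrictMono fun i => planeAngle (edge z i)} := by
  classical
  set G := {z : Fin n → ℂ | (InCones κ b z ∧ contactHeights κ s z ∈ A) ∧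
    StrictMono fun i => planeAngle (edge z i)} with hG
  have hGm : MeasurableSet G := ((measurableSet_inCones κ b).inter
    (measurable_contactHeights κ s hA)).inter (measurableSet_strictMono_planeAngle n)
  have hpre : ∀ σ : {σ : Equiv.Perm (Fin n) // b ∘ σ = b}, permEdges σ.1 ⁻¹' G =
      {z | (InCones κ b z ∧ contactHeights κ s z ∈ A) ∧
        StrictMono fun i => planeAngle (edge z (σ.1 i))} := by
    intro σ
    ext z
    simp only [hG, Set.mem_preimage, Set.mem_ofPred_eq, inCones_permEdges_iff σ.2,
      contactHeights_permEdges hsum hb σ.2, edge_permEdges]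
  have hae : {z : Fin n → ℂ | InCones κ b z ∧ contactHeights κ s z ∈ A} =ᵐ[volume]
      ⋃ σ : {σ : Equiv.Perm (Fin n) // b ∘ σ = b}, permEdges σ.1 ⁻¹' G := by
    filter_upwards [ae_generic κ n, ae_planeAngle_edge_injective hκ hn] with z hz hinj
    apply propext
    constructor
    · intro h
      refine Set.mem_iUnion.2 ⟨⟨_, comp_sort_eq hκ (by omega) hb hz h.1⟩, ?_⟩
      rw [hpre]
      exact ⟨h, (Tuple.monotone_sort _).strictMono_of_injective
        (hinj.comp (Equiv.injective _))⟩
    · intro h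
      obtain ⟨σ, hσ⟩ := Set.mem_iUnion.1 h
      rw [hpre] at hσ
      exact hσ.1
  rw [measure_congr hae, measure_iUnion]
  · simp only [volume_preimage_permEdges, tsum_fintype, Finset.sum_const, Finset.card_univ,
      ← Nat.card_eq_fintype_card, card_stabilizer hb hsum, nsmul_eq_mul, Nat.cast_prod]
  · intro σ τ hστ
    rw [Function.onFun, Set.disjoint_left]
    intro z h1 h2
    rw [hpre] at h1 h2
    apply hστ
    have hθ : Function.Injective fun i => planeAngle (edge z i) := by
      intro i k h
      have := h1.2.injective (a₁ := σ.1.symm i) (a₂ := σ.1.symm k) (by simpa using h)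
      simpa using this
    have := Tuple.unique_monotone (f := fun i => planeAngle (edge z i)) (σ := σ.1) (τ := τ.1)
      h1.2.monotone h2.2.monotone
    exact Subtype.ext (Equiv.ext fun i => hθ (congrFun this i))
  · exact fun σ => (permEdges σ.1).continuous_of_finiteDimensional.measurable hGm

end Sorting

/-! ### Measurability of the statistics -/

lemma measurable_nat_sInf {α : Type*} [MeasurableSpace α] {p : ℕ → α → Prop}
    (hp : ∀ k, MeasurableSet {a | p k a}) : Measurable fun a => sInf {k | p k a} := by
  refine measurable_to_countable' fun m => ?_
  have h : (fun a => sInf {k | p k a}) ⁻¹' {m} =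
      ({a | p m a} ∩ ⋂ k, ⋂ _ : k < m, {a | p k a}ᶜ) ∪ ({_a | m = 0} ∩ ⋂ k, {a | p k a}ᶜ) := by
    ext a
    simp only [Set.mem_preimage, Set.mem_singleton_iff, Set.mem_union, Set.mem_inter_iff,
      Set.mem_ofPred_eq, Set.mem_iInter, Set.mem_compl_iff]
    constructor
    · rintro rfl
      rcases Set.eq_empty_or_nonempty {k | p k a} with he | he
      · exact Or.inr ⟨by rw [he, Nat.sInf_empty], fun k hk => (he ▸ hk : k ∈ (∅ : Set ℕ))⟩
      · exact Or.inl ⟨Nat.sInf_mem he, fun k hk => Nat.notMem_of_lt_sInf hk⟩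
    · rintro (⟨h1, h2⟩ | ⟨rfl, h⟩)
      · exact le_antisymm (Nat.sInf_le h1) (not_lt.1 fun hlt => h2 _ hlt (Nat.sInf_mem (s := {k | p k a}) ⟨m, h1⟩))
      · rw [Set.eq_empty_of_forall_notMem (s := {k | p k a}) h, Nat.sInf_empty]
  rw [h]
  exact ((hp m).inter (MeasurableSet.iInter fun k => MeasurableSet.iInter fun _ => (hp k).compl)).union
    ((MeasurableSet.const _).inter (MeasurableSet.iInter fun k => (hp k).compl))

section Statistics

variable {κ n : ℕ}

lemma measurable_infDist_sideLine (κ : ℕ) (j : Fin κ) (i : Fin n) :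
    Measurable fun z : Fin n → ℂ => Metric.infDist (z i) (sideLine κ j : Set ℂ) :=
  ((Metric.continuous_infDist_pt _).comp (continuous_apply i)).measurable

lemma measurable_sideDist_apply (κ : ℕ) (j : Fin κ) :
    Measurable fun z : Fin n → ℂ => sideDist κ z j :=
  Measurable.iInf fun i => measurable_infDist_sideLine κ j i

lemma measurable_sideDist (κ n : ℕ) : Measurable fun z : Fin n → ℂ => sideDist κ z :=
  measurable_pi_iff.2 fun j => measurable_sideDist_apply κ j

lemma measurableSet_onECPSide (κ : ℕ) (j : Fin κ) (i : Fin n) :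
    MeasurableSet {z : Fin n → ℂ | OnECPSide κ z j i} :=
  measurableSet_eq_fun (measurable_infDist_sideLine κ j i) (measurable_sideDist_apply κ j)

lemma measurable_contactIndex (κ : ℕ) (j : Fin κ) :
    Measurable fun z : Fin n → ℂ => contactIndex κ z j := by
  refine measurable_nat_sInf fun k => ?_
  have hre : ∀ i : Fin n, Measurable fun z : Fin n → ℂ => (z i).re := fun i => by fun_prop
  have him : ∀ i : Fin n, Measurable fun z : Fin n → ℂ => (z i).im := fun i => by fun_prop
  by_cases hk : k < n
  · simp only [hk, exists_true_left]
    refine (measurableSet_onECPSide κ j _).inter ?_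
    change MeasurableSet {z : Fin n → ℂ | ∀ i, OnECPSide κ z j i →
      (z ⟨k, hk⟩).re < (z i).re ∨ (z ⟨k, hk⟩).re = (z i).re ∧ (z ⟨k, hk⟩).im ≤ (z i).im}
    rw [Set.ofPred_forall]
    refine MeasurableSet.iInter fun i => ?_
    exact (measurableSet_onECPSide κ j i).imp ((measurableSet_lt (hre _) (hre i)).union
      ((measurableSet_eq_fun (hre _) (hre i)).inter (measurableSet_le (him _) (him i))))
  · simp [hk]

lemma measurable_sizeVector (κ n : ℕ) : Measurable fun z : Fin n → ℂ => sizeVector κ z := by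
  refine measurable_pi_iff.2 fun j => ?_
  exact (Measurable.of_discrete (f := fun p : ℕ × ℕ => (p.1 + n - p.2) % n)).comp
    ((measurable_contactIndex κ (finRotate κ j)).prodMk (measurable_contactIndex κ j))

end Statistics

/-! ### The joint density -/

section Density

variable {κ n : ℕ} {s : Fin κ → ℕ}

lemma sum_pair_sub_one (hs : s ∈ admissibleSizes κ n) :
    (∑ j, (s ((finRotate κ).symm j) + s j - 1)) + κ = 2 * n := by
  have h : ∑ j, ((s ((finRotate κ).symm j) + s j - 1) + 1) = 2 * n := by
    rw [Finset.sum_congr rfl fun j _ => Nat.sub_add_cancel (Nat.one_le_iff_ne_zero.2 (hs.2 j)),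
      Finset.sum_add_distrib, Equiv.sum_comp (finRotate κ).symm, hs.1, two_mul]
  simpa [Finset.sum_add_distrib] using h

/-- The joint density up to its normalisation `n! / P̃_κ(n)`, for an admissible size-vector. -/
noncomputable def rawDensity (κ n : ℕ) (s : Fin κ → ℕ) (l : Fin κ → ℝ) : ℝ :=
  Real.sin (interiorAngle κ) ^ ((n : ℤ) - (κ : ℤ)) * (distDomain κ).indicator (fun _ => (1 : ℝ)) l *
    ∏ j, (sideLength κ - sideComb κ l j) ^ (s ((finRotate κ).symm j) + s j - 1) /
      ((s j)! * (s ((finRotate κ).symm j) + s j - 1)! : ℝ)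

/-- The Jacobian `sin(θ_κ)^{-n}` and the factors `sin(θ_κ)^{s_{j-1}+s_j-1}` of the simplices
combine to `sin(θ_κ)^{n-κ}`, because the exponents of the latter add up to `2n - κ`. -/
lemma prod_simplexVol_eq (hκ : 3 ≤ κ) (hs : s ∈ admissibleSizes κ n) {l : Fin κ → ℝ}
    (hl : ∀ j, 0 ≤ l j) :
    ENNReal.ofReal ((Real.sin (interiorAngle κ) ^ n)⁻¹) *
        ∏ j, simplexVol (s ((finRotate κ).symm j) + s j - 1)
          (Real.sin (interiorAngle κ) * (sideLength κ - sideComb κ l j)) =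
      (∏ j, ((s j)! : ENNReal)) * ENNReal.ofReal (rawDensity κ n s l) := by
  have hsin : 0 < Real.sin (interiorAngle κ) := by
    rw [sin_interiorAngle hκ]; exact sin_step_pos hκ
  by_cases hc : ∀ j, sideComb κ l j ≤ sideLength κ
  · have hc' : ∀ j, 0 ≤ Real.sin (interiorAngle κ) * (sideLength κ - sideComb κ l j) :=
      fun j => mul_nonneg hsin.le (sub_nonneg.2 (hc j))
    have hf : (∏ j, ((s j)! : ENNReal)) = ENNReal.ofReal (∏ j, ((s j)! : ℝ)) := by
      rw [ENNReal.ofReal_prod_of_nonneg fun _ _ => Nat.cast_nonneg _]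
      simp
    simp only [simplexVol, hc', if_true]
    rw [← ENNReal.ofReal_prod_of_nonneg fun j _ => div_nonneg (pow_nonneg (hc' j) _) (by positivity),
      ← ENNReal.ofReal_mul (by positivity), hf, ← ENNReal.ofReal_mul (by positivity)]
    congr 1
    have hz : Real.sin (interiorAngle κ) ^ ((n : ℤ) - (κ : ℤ)) =
        (Real.sin (interiorAngle κ) ^ n)⁻¹ *
          ∏ j, Real.sin (interiorAngle κ) ^ (s ((finRotate κ).symm j) + s j - 1) := by
      rw [Finset.prod_pow_eq_pow_sum, ← zpow_natCast, ← zpow_natCast, ← zpow_neg, ← zpow_add₀ hsin.ne']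
      congr 1
      have := sum_pair_sub_one hs
      zify at this ⊢
      linarith
    rw [rawDensity, Set.indicator_of_mem (show l ∈ distDomain κ from ⟨hl, hc⟩), hz, mul_one,
      mul_left_comm, mul_assoc, ← Finset.prod_mul_distrib,
      ← Finset.prod_mul_distrib]
    congr 1
    refine Finset.prod_congr rfl fun j _ => ?_
    rw [mul_pow]
    field_simp
  · have hl' : l ∉ distDomain κ := fun h => hc h.2
    push Not at hc
    obtain ⟨j, hj⟩ := hc
    rw [rawDensity, Set.indicator_of_notMem hl', mul_zero, zero_mul, ENNReal.ofReal_zero, mul_zero,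
      Finset.prod_eq_zero (Finset.mem_univ j), mul_zero]
    exact if_neg (not_le.2 (mul_neg_of_pos_of_neg hsin (by linarith)))

/-- The unnormalised law of the pair (distances, sizes). Almost everywhere, the canonically ordered
tuples of size-vector `s` are those whose edges are sorted and whose `j`-th block of edges lies in
the cone between the directions of the `j`-th and the next side. -/
lemma volume_fullSided_event (hκ : 3 ≤ κ) (hn : 3 ≤ n) (hs : s ∈ admissibleSizes κ n)
    {A : Set (Fin κ → ℝ)} (hA : MeasurableSet A) :
    volume {z : Fin n → ℂ | z ∈ fullSidedSet κ n ∧ sideDist κ z ∈ A ∧ sizeVector κ z = s} =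
      ∫⁻ l in A, ENNReal.ofReal (rawDensity κ n s l) := by
  have : NeZero n := ⟨by omega⟩
  obtain ⟨b, hb⟩ := exists_isBlockMap hs.1
  set B : Set (Fin κ → ℝ) := {l | ∀ j, 0 ≤ l j} with hB
  have hBm : MeasurableSet B := by
    rw [hB, Set.ofPred_forall]
    exact MeasurableSet.iInter fun j => measurableSet_le measurable_const (measurable_pi_apply j)
  have hae : {z : Fin n → ℂ | z ∈ fullSidedSet κ n ∧ sideDist κ z ∈ A ∧ sizeVector κ z = s} =ᵐ[volume]
      {z | (InCones κ b z ∧ contactHeights κ s z ∈ A ∩ B) ∧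
        StrictMono fun i => planeAngle (edge z i)} := by
    filter_upwards [ae_generic κ n] with z hz
    apply propext
    constructor
    · rintro ⟨hfull, hzA, hsize⟩
      obtain ⟨hc, hmono, hpos⟩ :=
        inCones_of_mem_fullSidedSet hκ (by omega) hz hs hb hfull hsize
      rw [sideDist_eq_contactHeights hκ (by omega) hz hs.1 hb hc hmono hpos] at hzA
      exact ⟨⟨hc, hzA, hpos⟩, hmono⟩
    · rintro ⟨⟨hc, hzA, hpos⟩, hmono⟩
      obtain ⟨hfull, hsize⟩ := mem_fullSidedSet_of_inCones hκ (by omega) hz hs hb hc hmono hpos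
      refine ⟨hfull, ?_, hsize⟩
      rwa [sideDist_eq_contactHeights hκ (by omega) hz hs.1 hb hc hmono hpos]
  have h1 := volume_inCones_eq_mul hκ hn hb hs.1 (hA.inter hBm)
  have h0 : (∏ j, ((s j)! : ENNReal)) ≠ 0 :=
    Finset.prod_ne_zero_iff.2 fun j _ => by exact_mod_cast (Nat.factorial_pos _).ne'
  have htop : (∏ j, ((s j)! : ENNReal)) ≠ ⊤ := ENNReal.prod_ne_top fun j _ => ENNReal.natCast_ne_top _
  rw [volume_inCones hκ hb hs (hA.inter hBm), ← measure_congr hae,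
    ← lintegral_const_mul' _ _ ENNReal.ofReal_ne_top,
    setLIntegral_congr_fun (hA.inter hBm) fun l hl => prod_simplexVol_eq hκ hs hl.2,
    lintegral_const_mul' _ _ htop] at h1
  rw [← (ENNReal.mul_right_inj h0 htop).1 h1, ← lintegral_indicator hA, ← lintegral_indicator (hA.inter hBm)]
  refine lintegral_congr fun l => ?_
  by_cases hl : l ∈ B
  · by_cases hlA : l ∈ A
    · rw [Set.indicator_of_mem hlA, Set.indicator_of_mem (show l ∈ A ∩ B from ⟨hlA, hl⟩)]
    · rw [Set.indicator_of_notMem hlA, Set.indicator_of_notMem fun h : l ∈ A ∩ B => hlA h.1]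
  · have : rawDensity κ n s l = 0 := by
      rw [rawDensity, Set.indicator_of_notMem fun h : l ∈ distDomain κ => hl h.1, mul_zero,
        zero_mul]
    rw [Set.indicator_of_notMem fun h : l ∈ A ∩ B => hl h.2]
    by_cases hlA : l ∈ A
    · rw [Set.indicator_of_mem hlA, this, ENNReal.ofReal_zero]
    · rw [Set.indicator_of_notMem hlA]

end Density

lemma uniformLaw_univ {κ : ℕ} (hκ : 3 ≤ κ) (n : ℕ) : uniformLaw κ n Set.univ = 1 := by
  rw [uniformLaw_eq hκ, Measure.restrict_apply_univ, volume_pi, Measure.pi_pi]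
  simp [volume_regularPolygon hκ]

theorem mainTheorem6 (κ n : ℕ) (hκ : 3 ≤ κ) (hn : 3 ≤ n)
    {Ω : Type*} [MeasurableSpace Ω] (P : Measure Ω) [IsProbabilityMeasure P]
    (z : Ω → Fin n → ℂ) (hz : HasLaw z (fullSidedLaw κ n) P) :
    AEMeasurable (fun ω => sideDist κ (z ω)) P ∧
    AEMeasurable (fun ω => sizeVector κ (z ω)) P ∧
    ∀ (s : Fin κ → ℕ) (A : Set (Fin κ → ℝ)), MeasurableSet A →
      P {ω | sideDist κ (z ω) ∈ A ∧ sizeVector κ (z ω) = s} =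
        ∫⁻ l in A, ENNReal.ofReal (jointDensity κ n l s) := by
  refine ⟨(measurable_sideDist κ n).comp_aemeasurable hz.aemeasurable,
    (measurable_sizeVector κ n).comp_aemeasurable hz.aemeasurable, fun s A hA => ?_⟩
  set F := fullSidedSet κ n with hF
  set E : Set (Fin n → ℂ) := {z | sideDist κ z ∈ A ∧ sizeVector κ z = s} with hE
  have hEm : MeasurableSet E :=
    (measurable_sideDist κ n hA).inter (measurable_sizeVector κ n (measurableSet_singleton s))
  have hU1 : uniformLaw κ n F ≤ 1 := (measure_mono (Set.subset_univ _)).trans (uniformLaw_univ hκ n).le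
  have hUtop : uniformLaw κ n F ≠ ⊤ := ne_top_of_le_ne_top ENNReal.one_ne_top hU1
  have hlaw : ∀ {B : Set (Fin n → ℂ)}, MeasurableSet B →
      fullSidedLaw κ n B = (uniformLaw κ n F)⁻¹ * uniformLaw κ n (B ∩ F) := fun hB => by
    rw [fullSidedLaw, ProbabilityTheory.cond, Measure.smul_apply, Measure.restrict_apply hB, smul_eq_mul]
  -- the conditioning event has positive probability, since the conditioned law exists
  have hU0 : uniformLaw κ n F ≠ 0 := by
    intro h0
    have := hz.isProbabilityMeasure_iff.1 inferInstance
    have h1 := measure_univ (μ := fullSidedLaw κ n)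
    rw [hlaw MeasurableSet.univ, Set.univ_inter, h0, mul_zero] at h1
    exact zero_ne_one h1
  have hEF : E ∩ F ⊆ Set.univ.pi fun _ : Fin n => regularPolygon κ := fun z hz i _ => hz.2.1.2 i
  rw [hz.measure_eq (p := fun z => sideDist κ z ∈ A ∧ sizeVector κ z = s) hEm, ← hE, hlaw hEm,
    uniformLaw_eq hκ, Measure.restrict_eq_self _ hEF, ← uniformLaw_eq hκ]
  by_cases hs : s ∈ admissibleSizes κ n
  · have hden : ∀ l, ENNReal.ofReal (jointDensity κ n l s) =
        (uniformLaw κ n F)⁻¹ * ENNReal.ofReal (rawDensity κ n s l) := by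
      intro l
      have hn0 : (n ! : ℝ) ≠ 0 := by positivity
      have hp : 0 < (uniformLaw κ n F).toReal := ENNReal.toReal_pos hU0 hUtop
      rw [← ENNReal.ofReal_toReal hUtop, ← ENNReal.ofReal_inv_of_pos hp,
        ← ENNReal.ofReal_mul (by positivity), jointDensity, rawDensity, Set.indicator_of_mem hs,
        fullSidedProb, Measure.real, ← hF]
      congr 1
      field_simp
    simp only [hden]
    rw [lintegral_const_mul' _ _ (ENNReal.inv_ne_top.2 hU0), ← volume_fullSided_event hκ hn hs hA,
      Set.inter_comm]
    rfl
  · have h0 : E ∩ F = ∅ := Set.eq_empty_of_forall_notMem fun z hz => hs (hz.1.2 ▸ hz.2.2)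
    simp [h0, jointDensity, hs]
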